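/- Let $P$ be a stochastic matrix of M/G/1 type, $$P=\begin{pmatrix}B_1&B_2&B_3&B_4&\cdots\\ B_0&A_1&A_2&A_3&\cdots\\ &A_0&A_1&A_2&\cdots\\ &&A_0&A_1&\cdots\\ &&&\ddots&\ddots\end{pmatrix},$$ where $B_1$ is $m_0\times m_0$, the $A_k$ are $m\times m$, $B_0$ is $m\times m_0$ and $B_k$ is $m_0\times m$ for $k\ge 2$. Assume that the Markov chain $P$ is irreducible and positive recurrent, let $x=(x_0,x_1,x_2,\dots)$ be its stationary probability vector, partitioned by levels, and put $\pi_k=\sum_{j\ge k}x_j$ for $k\ge 1$ and $\pi=(\pi_1,\pi_2,\dots)$. Let $G$ be the minimal nonnegative solution of $G=\sum_{k\ge0}A_kG^k$ and put $$\Psi=\sum_{k\ge1}A_kG^{k-1},\qquad R_{0,j}=\Big(\sum_{k\ge j+1}B_kG^{k-j-1}\Big)(I-\Psi)^{-1},\qquad R_j=\Big(\sum_{k\ge j+1}A_kG^{k-j-1}\Big)(I-\Psi)^{-1}\qquad(j\ge1),$$ and $R_j=0$ for $j\le 0$. Then $I-\Psi$ is invertible, all the series here and below converge, and: (a) for every $k\ge1$,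 $$\pi_k=x_0\sum_{j\ge k}R_{0,j}+\sum_{i\ge1}x_i\sum_{j\ge k}R_{j-i}.$$ (b) Let $\bar A_k=\sum_{j\ge k}A_j$, let $$\mathbf P=\begin{pmatrix}\bar A_1&\bar A_2&\bar A_3&\cdots\\ A_0&A_1&A_2&\cdots\\ &A_0&A_1&\cdots\\ &&\ddots&\ddots\end{pmatrix},\qquad G_1=(I-\Psi)^{-1}A_0,\qquad \widehat\Psi_0=\bar A_1+\sum_{k\ge2}\bar A_kG^{k-2}G_1,$$ $$\widehat R_{0,j}=\Big(\sum_{k\ge j+1}\bar A_kG^{k-j-1}\Big)(I-\Psi)^{-1}\quad(j\ge1),$$ let $\Psi_D=\mathrm{diag}(\widehat\Psi_0,\Psi,\Psi,\dots)$, let $G_L$ be the block matrix whose only nonzero blocks are $G_1,G,G,\dots$ just below the diagonal, and let $R_U$ be the strictly upper triangular block matrix with first row $(0,\widehat R_{0,1},\widehat R_{0,2},\dots)$ and with block $R_{j-i}$ in position $(i,j)$ for $2\le i<j$. For each $T\in\{\mathbf P,G_L,\Psi_D,R_U\}$ the series $(I-T)^{-1}:=\sum_{n\ge0}T^n$ converges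 entrywise and is a two-sided inverse of $I-T$, and $$\pi=\Big(x_0\sum_{j\ge2}B_j,\;x_0\sum_{j\ge3}B_j,\dots\Big)(I-\mathbf P)^{-1}=\Big(x_0\sum_{j\ge2}B_j,\;x_0\sum_{j\ge3}B_j,\dots\Big)(I-G_L)^{-1}(I-\Psi_D)^{-1}(I-R_U)^{-1}.$$ -/

import Mathlib

open scoped Matrix

noncomputable section

namespace MG1

section Chain

variable {S : Type*}

/-- `P` is a (row-)stochastic matrix on the countable state space `S`. -/
def IsStochastic (P : Matrix S S ℝ) : Prop :=
  (∀ i j, 0 ≤ P i j) ∧ ∀ i, HasSum (fun j => P i j) 1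

/-- `firstPassage P j n i` is the probability that the chain started in `i` visits `j` at step
`n + 1` and at none of the steps `1, …, n`. -/
def firstPassage [DecidableEq S] (P : Matrix S S ℝ) (j : S) : ℕ → S → ℝ
  | 0, i => P i j
  | n + 1, i => ∑' k, if k = j then 0 else P i k * firstPassage P j n k

/-- Every state is positive recurrent: the return to it is certain and the mean return time
is finite. -/
def IsPositiveRecurrent [DecidableEq S] (P : Matrix S S ℝ) : Prop :=
  ∀ i, HasSum (fun n => firstPassage P i n i) 1 ∧
    Summable (fun n : ℕ => ((n : ℝ) + 1) * firstPassage P i n i)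

/-- `x` is a stationary probability vector of `P`. -/
def IsStationary (P : Matrix S S ℝ) (x : S → ℝ) : Prop :=
  (∀ i, 0 ≤ x i) ∧ HasSum x 1 ∧ ∀ j, HasSum (fun i => x i * P i j) (x j)

end Chain

section Infinite

variable {m : ℕ}

/-- An infinite matrix, with rows and columns indexed by `ℕ`, of `m × m` blocks. -/
abbrev BlockMatrix (m : ℕ) : Type := Matrix ℕ ℕ (Matrix (Fin m) (Fin m) ℝ)

/-- The powers `Tⁿ` of an infinite block matrix. -/
def blockPow (T : BlockMatrix m) : ℕ → BlockMatrix m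
  | 0 => 1
  | n + 1 => fun i k => ∑' j, blockPow T n i j * T j k

/-- The minimal inverse `(I - T)⁻¹ = ∑ₙ Tⁿ` (entrywise sums) for a nonnegative `T`. -/
def minInv (T : BlockMatrix m) : BlockMatrix m := fun i k => ∑' n, blockPow T n i k

/-- The series `∑ₙ Tⁿ` converges entrywise, and its sum is a two-sided inverse of `I - T`
(all the infinite sums in the two matrix products being convergent). -/
def HasMinInv (T : BlockMatrix m) : Prop :=
  (∀ i k, Summable (fun n => blockPow T n i k)) ∧
  (∀ i k, HasSum (fun j => (1 - T) i j * minInv T j k) ((1 : BlockMatrix m) i k)) ∧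
  (∀ i k, HasSum (fun j => minInv T i j * (1 - T) j k) ((1 : BlockMatrix m) i k))

/-- `w = v M` for infinite block row vectors `v`, `w`, all the sums being convergent. -/
def IsVecMul (v : ℕ → Fin m → ℝ) (M : BlockMatrix m) (w : ℕ → Fin m → ℝ) : Prop :=
  ∀ k, HasSum (fun i => v i ᵥ* M i k) (w k)

end Infinite

/-- The blocks of a transition matrix of M/G/1 type
```
B₁ B₂ B₃ B₄ …
B₀ A₁ A₂ A₃ …
   A₀ A₁ A₂ …
      A₀ A₁ …
```
`B k` is the block `B_k` for `k ≥ 2`; the values `B 0` and `B 1` are never used. -/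
structure Blocks (m₀ m : ℕ) where
  B₀ : Matrix (Fin m) (Fin m₀) ℝ
  B₁ : Matrix (Fin m₀) (Fin m₀) ℝ
  B : ℕ → Matrix (Fin m₀) (Fin m) ℝ
  A : ℕ → Matrix (Fin m) (Fin m) ℝ

/-- The states: `Sum.inl a` is phase `a` of level `0`, and `Sum.inr (n, a)` is phase `a` of
level `n + 1`. -/
abbrev State (m₀ m : ℕ) : Type := Fin m₀ ⊕ (ℕ × Fin m)

/-- The part of a vector on the states that belongs to level `0`. -/
def levelZero {m₀ m : ℕ} (x : State m₀ m → ℝ) : Fin m₀ → ℝ := fun a => x (Sum.inl a)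

/-- The part of a vector on the states that belongs to level `n + 1`. -/
def levelSucc {m₀ m : ℕ} (x : State m₀ m → ℝ) (n : ℕ) : Fin m → ℝ := fun a => x (Sum.inr (n, a))

/-- The tail `π_{k+1} = ∑_{j ≥ k+1} x_j`. -/
def tail {m₀ m : ℕ} (x : State m₀ m → ℝ) (k : ℕ) : Fin m → ℝ := ∑' j, levelSucc x (k + j)

namespace Blocks

variable {m₀ m : ℕ} (D : Blocks m₀ m)

/-- The transition matrix of M/G/1 type with the given blocks. -/
def transition : Matrix (State m₀ m) (State m₀ m) ℝ
  | Sum.inl a, Sum.inl b => D.B₁ a b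
  | Sum.inl a, Sum.inr (n, b) => D.B (n + 2) a b
  | Sum.inr (0, a), Sum.inl b => D.B₀ a b
  | Sum.inr (_ + 1, _), Sum.inl _ => 0
  | Sum.inr (i, a), Sum.inr (j, b) => if i ≤ j + 1 then D.A (j + 1 - i) a b else 0

/-- `G` is the (entrywise) minimal nonnegative solution of `G = ∑_{k ≥ 0} A_k Gᵏ`. -/
def IsMinimalSolution (G : Matrix (Fin m) (Fin m) ℝ) : Prop :=
  (∀ a b, 0 ≤ G a b) ∧ HasSum (fun k => D.A k * G ^ k) G ∧
  ∀ H : Matrix (Fin m) (Fin m) ℝ, (∀ a b, 0 ≤ H a b) → HasSum (fun k => D.A k * H ^ k) H →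
    ∀ a b, G a b ≤ H a b

variable (G : Matrix (Fin m) (Fin m) ℝ)

/-- `Ψ = ∑_{k ≥ 1} A_k G^{k-1}`. -/
def Psi : Matrix (Fin m) (Fin m) ℝ := ∑' k, D.A (k + 1) * G ^ k

/-- `R_{0,j} = (∑_{k ≥ j+1} B_k G^{k-j-1}) (I - Ψ)⁻¹`, for `j ≥ 1`. -/
def R0 (j : ℕ) : Matrix (Fin m₀) (Fin m) ℝ :=
  (∑' k, D.B (j + 1 + k) * G ^ k) * (1 - D.Psi G)⁻¹

/-- `R_j = (∑_{k ≥ j+1} A_k G^{k-j-1}) (I - Ψ)⁻¹`, for `j ≥ 1`. -/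
def R (j : ℕ) : Matrix (Fin m) (Fin m) ℝ :=
  (∑' k, D.A (j + 1 + k) * G ^ k) * (1 - D.Psi G)⁻¹

/-- `R_{j-i}`, with the convention that it is `0` for `j ≤ i`. -/
def RDiff (i j : ℕ) : Matrix (Fin m) (Fin m) ℝ := if i < j then D.R G (j - i) else 0

/-- `Ā_k = ∑_{j ≥ k} A_j`. -/
def ATail (k : ℕ) : Matrix (Fin m) (Fin m) ℝ := ∑' j, D.A (k + j)

/-- The matrix **P** of the equation `π = π **P** + b` for the tails: its first row of blocks
is `Ā₁, Ā₂, …`, and the following rows are those of a matrix of M/G/1 type.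
Row and column `n` belong to level `n + 1`. -/
def tailMatrix : BlockMatrix m := fun i j =>
  if i = 0 then D.ATail (j + 1) else if i ≤ j + 1 then D.A (j + 1 - i) else 0

/-- `G₁ = (I - Ψ)⁻¹ A₀`, the boundary entry of the `G`-measure of **P**. -/
def G1 : Matrix (Fin m) (Fin m) ℝ := (1 - D.Psi G)⁻¹ * D.A 0

/-- `Ψ̂₀ = Ā₁ + ∑_{k ≥ 2} Ā_k G^{k-2} G₁`. -/
def PsiHat0 : Matrix (Fin m) (Fin m) ℝ :=
  D.ATail 1 + ∑' k, D.ATail (k + 2) * G ^ k * D.G1 G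

/-- The first row of the `R`-measure of **P**:
`R̂_{0,j} = (∑_{k ≥ j+1} Ā_k G^{k-j-1}) (I - Ψ)⁻¹`, for `j ≥ 1`. -/
def RHat0 (j : ℕ) : Matrix (Fin m) (Fin m) ℝ :=
  (∑' k, D.ATail (j + 1 + k) * G ^ k) * (1 - D.Psi G)⁻¹

/-- `R_U`: first row `0, R̂_{0,1}, R̂_{0,2}, …`, and `R_{j-i}` strictly above the diagonal in the
other rows. -/
def RU : BlockMatrix m := fun i j =>
  if i < j then (if i = 0 then D.RHat0 G j else D.R G (j - i)) else 0

/-- `Ψ_D = diag (Ψ̂₀, Ψ, Ψ, …)`. -/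
def PsiD : BlockMatrix m := Matrix.diagonal fun i => if i = 0 then D.PsiHat0 G else D.Psi G

/-- `G_L`: the entries just below the diagonal are `G₁, G, G, …`, all others are `0`. -/
def lowerG : BlockMatrix m := fun i j =>
  if i = j + 1 then (if j = 0 then D.G1 G else G) else 0

/-- The block row vector `(x₀ ∑_{j ≥ 2} B_j, x₀ ∑_{j ≥ 3} B_j, …)`. -/
def boundary (x : State m₀ m → ℝ) (i : ℕ) : Fin m → ℝ :=
  levelZero x ᵥ* ∑' j, D.B (i + 2 + j)

end Blocks

end MG1

end

noncomputable section

namespace MG1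

open Filter Topology

/-! ### Nonnegative matrices, entrywise series, interchange of sums, convolutions -/

section Tools

variable {X p q r : Type*}

/-! Let y be the part of x on the levels ≥ 1, Q the transition matrix restricted to these levels, β
the inflow from level 0 and b the sequence of tails of β, so that y = β + yQ. Taking tails turns Q
into **P** (`hasSum_vecStep_killed`), which gives π = b + π**P** (`tail_eq`). Iterating, ∑ b**P**ⁿ
stays below π; every state is accessible from b under **P**, so the powers of **P** are summable
entrywise (`summable_blockPow`). The remainder π**P**ⁿ consists of the tails of yQⁿ. The limit of
yQⁿ is summable and Q-invariant; extended by 0 to level 0 it is invariant for the irreducible chain,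
hence zero. By dominated convergence π**P**ⁿ → 0, and π = b(I - **P**)⁻¹.

The inverse N = ∑ **P**ⁿ also controls G. As G is the limit of a monotone iteration from 0, every
nonnegative sequence with ∑ A_l N_{j+l} ≤ N_{j+1} satisfies GᵏN_j ≤ N_{j+k} (`pow_mul_le_of_super`).
A constant column of ones bounds the entries of Gᵏ by 1. A block column of N, inserted into N = I +
**P**N, gives N₁₁ ≥ I + ΨN₁₁ and N₀₀ ≥ I + Ψ̂₀N₀₀ (block indices from 0), so the Neumann series of Ψ
and Ψ̂₀ converge.

The factorization is carried out on vectors (`hasSum_mul_pow_of_eq`): u = π(I - R_U)(I - Ψ_D)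
satisfies u_k = b_k + u_{k+1}G with u_k → 0 and Gⁿ bounded, so u_k = ∑ b_{k+n}Gⁿ. Since A₀ = (I -
Ψ)G, one has G₁ = G, and this series is b(I - G_L)⁻¹; the other two factors are then inverted. The
same argument for y instead of π gives Ramaswami's recursion, and summing it over the levels gives
(a). -/

/-- Entrywise nonnegativity of a matrix. -/
def Nonneg (M : Matrix p q ℝ) : Prop := ∀ a b, 0 ≤ M a b

theorem hasSum_matrix_iff {f : X → Matrix p q ℝ} {M : Matrix p q ℝ} :
    HasSum f M ↔ ∀ a b, HasSum (fun i => f i a b) (M a b) :=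
  Pi.hasSum.trans (forall_congr' fun _ => Pi.hasSum)

theorem summable_matrix_iff {f : X → Matrix p q ℝ} :
    Summable f ↔ ∀ a b, Summable (fun i => f i a b) :=
  Pi.summable.trans (forall_congr' fun _ => Pi.summable)

theorem tendsto_matrix_iff {f : X → Matrix p q ℝ} {M : Matrix p q ℝ} {l : Filter X} :
    Tendsto f l (𝓝 M) ↔ ∀ a b, Tendsto (fun i => f i a b) l (𝓝 (M a b)) :=
  tendsto_pi_nhds.trans (forall_congr' fun _ => tendsto_pi_nhds)

theorem tsum_matrix_apply {f : X → Matrix p q ℝ} (h : Summable f) (a : p) (b : q) :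
    (∑' i, f i) a b = ∑' i, f i a b :=
  (hasSum_matrix_iff.1 h.hasSum a b).tsum_eq.symm

namespace Nonneg

theorem zero : Nonneg (0 : Matrix p q ℝ) := fun _ _ => le_rfl

theorem one [DecidableEq p] : Nonneg (1 : Matrix p p ℝ) := fun a b => by
  rw [Matrix.one_apply]; split_ifs <;> norm_num

theorem add {M N : Matrix p q ℝ} (hM : Nonneg M) (hN : Nonneg N) : Nonneg (M + N) :=
  fun a b => add_nonneg (hM a b) (hN a b)

theorem mul [Fintype q] {M : Matrix p q ℝ} {N : Matrix q r ℝ} (hM : Nonneg M) (hN : Nonneg N) :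
    Nonneg (M * N) := fun a b =>
  Finset.sum_nonneg fun c _ => mul_nonneg (hM a c) (hN c b)

theorem pow [Fintype p] [DecidableEq p] {M : Matrix p p ℝ} (hM : Nonneg M) (n : ℕ) :
    Nonneg (M ^ n) := by
  induction n with
  | zero => simpa using one
  | succ n ih => simpa [pow_succ] using ih.mul hM

theorem of_hasSum {f : X → Matrix p q ℝ} {M : Matrix p q ℝ} (h : ∀ i, Nonneg (f i))
    (hf : HasSum f M) : Nonneg M := fun a b =>
  (hasSum_matrix_iff.1 hf a b).nonneg fun i => h i a b

theorem tsum {f : X → Matrix p q ℝ} (h : ∀ i, Nonneg (f i)) : Nonneg (∑' i, f i) := by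
  by_cases hf : Summable f
  · exact of_hasSum h hf.hasSum
  · rw [tsum_eq_zero_of_not_summable hf]; exact zero

theorem of_tendsto {f : X → Matrix p q ℝ} {M : Matrix p q ℝ} {l : Filter X} [l.NeBot]
    (h : ∀ i, Nonneg (f i)) (hf : Tendsto f l (𝓝 M)) : Nonneg M := fun a b =>
  ge_of_tendsto' (tendsto_matrix_iff.1 hf a b) fun i => h i a b

theorem sub_trans {K M N : Matrix p q ℝ} (h₁ : Nonneg (M - K)) (h₂ : Nonneg (N - M)) :
    Nonneg (N - K) := by
  simpa using h₂.add h₁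

theorem summable {f g : X → Matrix p q ℝ} (hf : ∀ i, Nonneg (f i))
    (hfg : ∀ i, Nonneg (g i - f i)) (hg : Summable g) : Summable f :=
  summable_matrix_iff.2 fun a b => Summable.of_nonneg_of_le (fun i => hf i a b)
    (fun i => sub_nonneg.1 (hfg i a b)) (summable_matrix_iff.1 hg a b)

theorem vecMul [Fintype p] {v : p → ℝ} (hv : 0 ≤ v) {M : Matrix p q ℝ} (hM : Nonneg M) :
    0 ≤ v ᵥ* M := fun b =>
  Finset.sum_nonneg fun a _ => mul_nonneg (hv a) (hM a b)

end Nonneg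

theorem HasSum.const_mulMatrix [Fintype q] {f : X → Matrix q r ℝ} {M : Matrix q r ℝ}
    (C : Matrix p q ℝ) (h : HasSum f M) : HasSum (fun i => C * f i) (C * M) :=
  hasSum_matrix_iff.2 fun a b => hasSum_sum fun c _ => (hasSum_matrix_iff.1 h c b).mul_left (C a c)

theorem HasSum.mulMatrix_const [Fintype q] {f : X → Matrix p q ℝ} {M : Matrix p q ℝ}
    (C : Matrix q r ℝ) (h : HasSum f M) : HasSum (fun i => f i * C) (M * C) :=
  hasSum_matrix_iff.2 fun a b => hasSum_sum fun c _ => (hasSum_matrix_iff.1 h a c).mul_right (C c b)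

theorem HasSum.const_vecMul [Fintype p] {f : X → Matrix p q ℝ} {M : Matrix p q ℝ}
    (v : p → ℝ) (h : HasSum f M) : HasSum (fun i => v ᵥ* f i) (v ᵥ* M) :=
  Pi.hasSum.2 fun b => hasSum_sum fun c _ => (hasSum_matrix_iff.1 h c b).mul_left (v c)

theorem HasSum.vecMul_const [Fintype p] {f : X → p → ℝ} {v : p → ℝ}
    (M : Matrix p q ℝ) (h : HasSum f v) : HasSum (fun i => f i ᵥ* M) (v ᵥ* M) :=
  Pi.hasSum.2 fun b => hasSum_sum fun c _ => (Pi.hasSum.1 h c).mul_right (M c b)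

/-- Tonelli's theorem for a nonnegative double series. -/
theorem tonelli {f : ℕ → ℕ → ℝ} (hf : ∀ i j, 0 ≤ f i j) {g : ℕ → ℝ} {s : ℝ}
    (h : ∀ i, HasSum (f i) (g i)) (hg : HasSum g s) :
    (∀ j, Summable (fun i => f i j)) ∧ HasSum (fun j => ∑' i, f i j) s := by
  have hs : Summable (fun x : ℕ × ℕ => f x.1 x.2) := by
    refine (summable_prod_of_nonneg fun x => hf x.1 x.2).2 ⟨fun i => (h i).summable, ?_⟩
    simpa only [(h _).tsum_eq] using hg.summable
  have hsum : HasSum (fun x : ℕ × ℕ => f x.1 x.2) s := by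
    have := hs.hasSum.prod_fiberwise (fun i => h i)
    rw [hg.unique this]
    exact hs.hasSum
  have hsw : HasSum (fun x : ℕ × ℕ => f x.2 x.1) s :=
    (Equiv.prodComm ℕ ℕ).hasSum_iff.2 hsum
  have hcol : ∀ j, Summable (fun i => f i j) := fun j => hsw.summable.prod_factor j
  exact ⟨hcol, hsw.prod_fiberwise fun j => (hcol j).hasSum⟩

theorem tonelli_vec {f : ℕ → ℕ → p → ℝ} (hf : ∀ i j, 0 ≤ f i j) {g : ℕ → p → ℝ} {s : p → ℝ}
    (h : ∀ i, HasSum (f i) (g i)) (hg : HasSum g s) :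
    (∀ j, Summable (fun i => f i j)) ∧ HasSum (fun j => ∑' i, f i j) s := by
  have key := fun a => tonelli (fun i j => hf i j a) (fun i => Pi.hasSum.1 (h i) a)
    (Pi.hasSum.1 hg a)
  have hs : ∀ j, Summable (fun i => f i j) := fun j => Pi.summable.2 fun a => (key a).1 j
  refine ⟨hs, Pi.hasSum.2 fun a => ?_⟩
  convert (key a).2 using 2 with j
  exact tsum_apply (hs j)

theorem tonelli_matrix {f : ℕ → ℕ → Matrix p q ℝ} (hf : ∀ i j, Nonneg (f i j))
    {g : ℕ → Matrix p q ℝ} {s : Matrix p q ℝ} (h : ∀ i, HasSum (f i) (g i)) (hg : HasSum g s) :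
    (∀ j, Summable (fun i => f i j)) ∧ HasSum (fun j => ∑' i, f i j) s := by
  have key := fun a b => tonelli (fun i j => hf i j a b) (fun i => hasSum_matrix_iff.1 (h i) a b)
    (hasSum_matrix_iff.1 hg a b)
  have hs : ∀ j, Summable (fun i => f i j) := fun j =>
    summable_matrix_iff.2 fun a b => (key a b).1 j
  refine ⟨hs, hasSum_matrix_iff.2 fun a b => ?_⟩
  convert (key a b).2 using 2 with j
  exact tsum_matrix_apply (hs j) a b

/-- The convolution of a null sequence with a summable one is a null sequence. -/
theorem tendsto_convolution {f g : ℕ → ℝ} (hf : Tendsto f atTop (𝓝 0)) (hg : Summable g) :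
    Tendsto (fun k => ∑ i ∈ Finset.range (k + 1), f i * g (k - i)) atTop (𝓝 0) := by
  obtain ⟨C, hC⟩ := (Metric.isBounded_range_of_tendsto f hf).exists_norm_le
  have hC' : ∀ i, ‖f i‖ ≤ C := fun i => hC _ ⟨i, rfl⟩
  have hC0 : 0 ≤ C := (norm_nonneg _).trans (hC' 0)
  -- Reversed and cut off at j ≤ k, the convolution is a series in j dominated by C‖g j‖, each term
  -- of which tends to 0.
  have key : Tendsto (fun k => ∑' j, if j ≤ k then f (k - j) * g j else 0) atTop
      (𝓝 (∑' _ : ℕ, (0 : ℝ))) := by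
    refine tendsto_tsum_of_dominated_convergence (bound := fun j => C * ‖g j‖)
      (hg.norm.mul_left C) (fun j => ?_) (Eventually.of_forall fun k j => ?_)
    · have h1 : Tendsto (fun k => f (k - j) * g j) atTop (𝓝 (0 * g j)) :=
        (hf.comp (tendsto_sub_atTop_nat j)).mul_const _
      rw [zero_mul] at h1
      refine h1.congr' ?_
      filter_upwards [eventually_ge_atTop j] with k hk
      rw [if_pos hk]
    · split_ifs
      · rw [norm_mul]; exact mul_le_mul_of_nonneg_right (hC' _) (norm_nonneg _)
      · rw [norm_zero]; positivity
  rw [tsum_zero] at key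
  refine key.congr fun k => ?_
  rw [tsum_eq_sum (s := Finset.range (k + 1))]
  · rw [← Finset.sum_range_reflect]
    refine Finset.sum_congr rfl fun j hj => ?_
    have hj' : j ≤ k := Nat.lt_succ_iff.1 (Finset.mem_range.1 hj)
    rw [if_pos (by omega)]
    congr 2; omega
  · intro j hj
    rw [if_neg]; simpa using hj

theorem tendsto_convolution_vecMul [Fintype p] {f : ℕ → p → ℝ} {g : ℕ → Matrix p q ℝ}
    (hf : Tendsto f atTop (𝓝 0)) (hg : Summable g) :
    Tendsto (fun k => ∑ i ∈ Finset.range (k + 1), f i ᵥ* g (k - i)) atTop (𝓝 0) := by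
  refine tendsto_pi_nhds.2 fun b => ?_
  have h : ∀ a : p, Tendsto (fun k => ∑ i ∈ Finset.range (k + 1), f i a * g (k - i) a b)
      atTop (𝓝 0) := fun a =>
    tendsto_convolution (tendsto_pi_nhds.1 hf a) (summable_matrix_iff.1 hg a b)
  have h' : Tendsto (fun k => ∑ a : p, ∑ i ∈ Finset.range (k + 1), f i a * g (k - i) a b)
      atTop (𝓝 (∑ _a : p, 0)) := tendsto_finsetSum Finset.univ fun a _ => h a
  rw [Finset.sum_const_zero] at h'
  refine h'.congr fun k => ?_
  rw [Finset.sum_comm, Finset.sum_apply]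
  rfl

end Tools

/-! ### Subinvariant vectors of irreducible and stochastic matrices -/

section Chain

variable {S : Type*}

/-- A nonempty set of states that is closed under the transitions of an irreducible matrix
contains every state. -/
theorem forall_of_isIrreducible {P : Matrix S S ℝ} (h : P.IsIrreducible) (C : S → Prop)
    (hstep : ∀ i j, C i → 0 < P i j → C j) {i : S} (hi : C i) (j : S) : C j := by
  let _ : Quiver S := P.toQuiver
  obtain ⟨path, -⟩ := h.connected i j
  induction path with
  | nil => exact hi
  | cons _ e ih => exact hstep _ _ ih e.down

/-- A nonnegative subinvariant vector of an irreducible matrix that is positive somewhere is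
positive everywhere. -/
theorem pos_of_subinvariant {P : Matrix S S ℝ} (h : P.IsIrreducible) {w : S → ℝ}
    (hsub : ∀ i j, w i * P i j ≤ w j) {i : S} (hi : 0 < w i) (j : S) : 0 < w j :=
  forall_of_isIrreducible h (fun s => 0 < w s)
    (fun s t hs hst => (mul_pos hs hst).trans_le (hsub s t)) hi j

/-- A summable nonnegative vector `w ≤ w P` is invariant. -/
theorem invariant_of_le {P : Matrix S S ℝ} (hP : IsStochastic P) {w : S → ℝ} (hw : ∀ i, 0 ≤ w i)
    (hws : Summable w) {w' : S → ℝ} (hw' : ∀ j, HasSum (fun i => w i * P i j) (w' j))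
    (hle : ∀ j, w j ≤ w' j) (j : S) : w' j = w j := by
  have hs : Summable (fun x : S × S => w x.1 * P x.1 x.2) := by
    have h0 : 0 ≤ fun x : S × S => w x.1 * P x.1 x.2 :=
      fun x => mul_nonneg (hw x.1) (hP.1 x.1 x.2)
    refine (summable_prod_of_nonneg h0).2 ⟨fun i => (hP.2 i).summable.mul_left (w i), ?_⟩
    have h1 : ∀ i, ∑' j, w i * P i j = w i := fun i => by
      rw [tsum_mul_left, (hP.2 i).tsum_eq, mul_one]
    simpa only [h1] using hws
  -- Rows of `P` sum to 1, so `w` and `w'` have the same total mass; the nonnegative difference then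
  -- has sum 0 and vanishes.
  have h1 : HasSum w (∑' x : S × S, w x.1 * P x.1 x.2) :=
    hs.hasSum.prod_fiberwise fun i => by simpa using (hP.2 i).mul_left (w i)
  have h2 : HasSum w' (∑' x : S × S, w x.1 * P x.1 x.2) :=
    ((Equiv.prodComm S S).hasSum_iff.2 hs.hasSum).prod_fiberwise fun j => hw' j
  have h3 := h2.sub h1
  rw [sub_self] at h3
  have := (hasSum_zero_iff_of_nonneg fun j => sub_nonneg.2 (hle j)).1 h3
  exact sub_eq_zero.1 (congrFun this j)

end Chain

/-! ### Powers and minimal inverses of infinite block matrices -/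

section BlockPow

variable {m : ℕ} {T : BlockMatrix m}

/-- The block row vector `w T`, for a block matrix `T` that vanishes below its subdiagonal. -/
def vecStep (T : BlockMatrix m) (w : ℕ → Fin m → ℝ) (k : ℕ) : Fin m → ℝ :=
  ∑ j ∈ Finset.range (k + 2), w j ᵥ* T j k

theorem vecStep_add (v w : ℕ → Fin m → ℝ) : vecStep T (v + w) = vecStep T v + vecStep T w := by
  funext k
  simp [vecStep, Matrix.add_vecMul, Finset.sum_add_distrib]

theorem iterate_vecStep_add (v w : ℕ → Fin m → ℝ) (n : ℕ) :
    (vecStep T)^[n] (v + w) = (vecStep T)^[n] v + (vecStep T)^[n] w := by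
  induction n with
  | zero => rfl
  | succ n ih => rw [Function.iterate_succ_apply', ih, vecStep_add,
      Function.iterate_succ_apply', Function.iterate_succ_apply']

theorem iterate_vecStep_nonneg (hT : ∀ i j, Nonneg (T i j)) {w : ℕ → Fin m → ℝ} (hw : ∀ i, 0 ≤ w i)
    (n k : ℕ) : 0 ≤ (vecStep T)^[n] w k := by
  induction n generalizing k with
  | zero => exact hw k
  | succ n ih =>
    rw [Function.iterate_succ_apply']
    exact Finset.sum_nonneg fun j _ => Nonneg.vecMul (ih j) (hT j k)

theorem eq_sum_add_iterate_vecStep {b w : ℕ → Fin m → ℝ} (h : w = b + vecStep T w) (n : ℕ) :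
    w = ∑ i ∈ Finset.range n, (vecStep T)^[i] b + (vecStep T)^[n] w := by
  induction n with
  | zero => simp
  | succ n ih =>
    rw [Finset.sum_range_succ, Function.iterate_succ_apply, add_assoc, ← iterate_vecStep_add, ← h]
    exact ih

theorem blockPow_nonneg (hT : ∀ i j, Nonneg (T i j)) (n i k : ℕ) : Nonneg (blockPow T n i k) := by
  induction n generalizing k with
  | zero =>
    rw [blockPow, Matrix.one_apply]
    split_ifs
    exacts [Nonneg.one, Nonneg.zero]
  | succ n ih => exact Nonneg.tsum fun j => (ih j).mul (hT j k)

theorem blockPow_succ (hz : ∀ j k, k + 2 ≤ j → T j k = 0) (n i k : ℕ) :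
    blockPow T (n + 1) i k = ∑ j ∈ Finset.range (k + 2), blockPow T n i j * T j k := by
  change ∑' j, blockPow T n i j * T j k = _
  rw [tsum_eq_sum]
  intro j hj
  rw [hz j k (by simpa using hj), mul_zero]

/-- One step descends at most one level, so n steps descend at most n. Hence each column of a power
has finite support, and powers multiply on either side without convergence assumptions. -/
theorem blockPow_eq_zero (hz : ∀ j k, k + 2 ≤ j → T j k = 0) {n i k : ℕ} (h : k + n < i) :
    blockPow T n i k = 0 := by
  induction n generalizing k with
  | zero => rw [blockPow, Matrix.one_apply, if_neg (by omega)]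
  | succ n ih =>
    rw [blockPow_succ hz]
    refine Finset.sum_eq_zero fun j hj => ?_
    rw [Finset.mem_range] at hj
    rw [ih (by omega), zero_mul]

theorem blockPow_succ_left (hz : ∀ j k, k + 2 ≤ j → T j k = 0) {n i k K : ℕ} (hK : k + n < K) :
    blockPow T (n + 1) i k = ∑ j ∈ Finset.range K, T i j * blockPow T n j k := by
  induction n generalizing k with
  | zero =>
    have h1 : blockPow T 1 i k = T i k := by
      rw [blockPow_succ hz]
      simp only [blockPow, Matrix.one_apply, ite_mul, one_mul, zero_mul]
      rw [Finset.sum_ite_eq]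
      split_ifs with h
      · rfl
      · rw [hz i k (by simpa using h)]
    rw [h1]
    simp only [blockPow, Matrix.one_apply, mul_ite, mul_one, mul_zero]
    rw [Finset.sum_ite_eq' , if_pos (by simpa using hK)]
  | succ n ih =>
    rw [blockPow_succ hz]
    have h1 : ∀ l ∈ Finset.range (k + 2), blockPow T (n + 1) i l * T l k =
        ∑ j ∈ Finset.range K, T i j * (blockPow T n j l * T l k) := fun l hl => by
      rw [Finset.mem_range] at hl
      rw [ih (by omega), Finset.sum_mul]
      simp only [Matrix.mul_assoc]
    rw [Finset.sum_congr rfl h1, Finset.sum_comm]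
    refine Finset.sum_congr rfl fun j _ => ?_
    rw [blockPow_succ hz, Finset.mul_sum]

theorem hasSum_mul_blockPow (hz : ∀ j k, k + 2 ≤ j → T j k = 0) (n i k : ℕ) :
    HasSum (fun j => T i j * blockPow T n j k) (blockPow T (n + 1) i k) := by
  rw [blockPow_succ_left hz (Nat.lt_succ_self (k + n))]
  refine hasSum_sum_of_ne_finset_zero fun j hj => ?_
  rw [blockPow_eq_zero hz (by simpa using hj), mul_zero]

theorem minInv_nonneg (hT : ∀ i j, Nonneg (T i j)) (i k : ℕ) : Nonneg (minInv T i k) :=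
  Nonneg.tsum fun n => blockPow_nonneg hT n i k

theorem hasSum_blockPow_succ (hs : ∀ i k, Summable (fun n => blockPow T n i k)) (i k : ℕ) :
    HasSum (fun n => blockPow T (n + 1) i k) (minInv T i k - (1 : BlockMatrix m) i k) := by
  have h := (hasSum_nat_add_iff' (f := fun n => blockPow T n i k) 1).2 (hs i k).hasSum
  rwa [Finset.sum_range_one] at h

/-- Rows of `T` may be infinite, so on this side the sums over n and j are exchanged by Tonelli;
multiplication on the right involves only finite columns. -/
theorem hasSum_mul_minInv (hT : ∀ i j, Nonneg (T i j)) (hz : ∀ j k, k + 2 ≤ j → T j k = 0)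
    (hs : ∀ i k, Summable (fun n => blockPow T n i k)) (i k : ℕ) :
    HasSum (fun j => T i j * minInv T j k) (minInv T i k - (1 : BlockMatrix m) i k) := by
  have h := (tonelli_matrix (fun n j => (hT i j).mul (blockPow_nonneg hT n j k))
    (fun n => hasSum_mul_blockPow hz n i k) (hasSum_blockPow_succ hs i k)).2
  convert h using 2 with j
  exact (HasSum.const_mulMatrix (T i j) (hs j k).hasSum).tsum_eq.symm

/-- A nonnegative block matrix that vanishes below its subdiagonal and whose powers are summable
has a minimal inverse. -/
theorem hasMinInv_of_summable (hT : ∀ i j, Nonneg (T i j)) (hz : ∀ j k, k + 2 ≤ j → T j k = 0)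
    (hs : ∀ i k, Summable (fun n => blockPow T n i k)) : HasMinInv T := by
  refine ⟨hs, fun i k => ?_, fun i k => ?_⟩
  · have h1 : HasSum (fun j => (1 : BlockMatrix m) i j * minInv T j k) (minInv T i k) := by
      convert hasSum_single (f := fun j => (1 : BlockMatrix m) i j * minInv T j k) i
        (fun j hj => ?_) using 1
      · simp
      · simp [Matrix.one_apply_ne' hj]
    have h2 := h1.sub (hasSum_mul_minInv hT hz hs i k)
    simp only [sub_sub_cancel, ← sub_mul] at h2
    exact h2
  · have h1 : HasSum (fun j => minInv T i j * (1 : BlockMatrix m) j k) (minInv T i k) := by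
      convert hasSum_single (f := fun j => minInv T i j * (1 : BlockMatrix m) j k) k
        (fun j hj => ?_) using 1
      · simp
      · simp [Matrix.one_apply_ne hj]
    have h2 : HasSum (fun j => minInv T i j * T j k)
        (minInv T i k - (1 : BlockMatrix m) i k) := by
      have h3 : HasSum (fun n => blockPow T (n + 1) i k)
          (∑ j ∈ Finset.range (k + 2), minInv T i j * T j k) := by
        simp only [blockPow_succ hz]
        exact hasSum_sum fun j _ => HasSum.mulMatrix_const _ (hs i j).hasSum
      rw [(hasSum_blockPow_succ hs i k).unique h3]
      refine hasSum_sum_of_ne_finset_zero fun j hj => ?_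
      rw [hz j k (by simpa using hj), mul_zero]
    have h4 := h1.sub h2
    simp only [sub_sub_cancel, ← mul_sub] at h4
    exact h4

theorem hasSum_vecMul_blockPow (hz : ∀ j k, k + 2 ≤ j → T j k = 0) (b : ℕ → Fin m → ℝ) (n k : ℕ) :
    HasSum (fun i => b i ᵥ* blockPow T n i k) ((vecStep T)^[n] b k) := by
  induction n generalizing k with
  | zero =>
    convert hasSum_single (f := fun i => b i ᵥ* blockPow T 0 i k) k (fun j hj => ?_) using 1
    · simp [blockPow]
    · simp [blockPow, Matrix.one_apply_ne hj]
  | succ n ih =>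
    simp only [Function.iterate_succ_apply', vecStep, blockPow_succ hz, Matrix.vecMul_sum,
      ← Matrix.vecMul_vecMul]
    exact hasSum_sum fun j _ => HasSum.vecMul_const _ (ih j)

theorem mul_blockPow_le (hT : ∀ i j, Nonneg (T i j)) (hz : ∀ j k, k + 2 ≤ j → T j k = 0)
    {b : ℕ → Fin m → ℝ} (hb : ∀ i, 0 ≤ b i) (n i k : ℕ) (a d : Fin m) :
    b i a * blockPow T n i k a d ≤ (vecStep T)^[n] b k d := by
  have h1 : b i a * blockPow T n i k a d ≤ (b i ᵥ* blockPow T n i k) d :=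
    Finset.single_le_sum (f := fun a => b i a * blockPow T n i k a d)
      (fun c _ => mul_nonneg (hb i c) (blockPow_nonneg hT n i k c d)) (Finset.mem_univ a)
  refine h1.trans ?_
  exact le_hasSum (Pi.hasSum.1 (hasSum_vecMul_blockPow hz b n k) d) i fun j _ =>
    Nonneg.vecMul (hb j) (blockPow_nonneg hT n j k) d

theorem iterate_vecStep_succ_pos (hT : ∀ i j, Nonneg (T i j)) (hz : ∀ j k, k + 2 ≤ j → T j k = 0)
    {b : ℕ → Fin m → ℝ} (hb : ∀ i, 0 ≤ b i) {n i k : ℕ} {a d : Fin m}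
    (h : 0 < (vecStep T)^[n] b i a) (hik : 0 < T i k a d) : 0 < (vecStep T)^[n + 1] b k d := by
  have hi : i ∈ Finset.range (k + 2) := by
    by_contra hi
    rw [hz i k (by simpa using hi)] at hik
    exact lt_irrefl _ hik
  rw [Function.iterate_succ_apply', vecStep, Finset.sum_apply]
  have h0 := iterate_vecStep_nonneg hT hb n
  refine (mul_pos h hik).trans_le (le_trans ?_ (Finset.single_le_sum
    (f := fun j => ((vecStep T)^[n] b j ᵥ* T j k) d)
    (fun j _ => Nonneg.vecMul (h0 j) (hT j k) d) hi))
  exact Finset.single_le_sum (f := fun a => (vecStep T)^[n] b i a * T i k a d)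
      (fun c _ => mul_nonneg (h0 i c) (hT i k c d)) (Finset.mem_univ a)

theorem summable_iterate_vecStep (hT : ∀ i j, Nonneg (T i j)) {b w : ℕ → Fin m → ℝ}
    (hb : ∀ i, 0 ≤ b i) (hw : ∀ i, 0 ≤ w i) (h : w = b + vecStep T w) (k : ℕ) (d : Fin m) :
    Summable (fun n => (vecStep T)^[n] b k d) := by
  refine summable_of_sum_range_le (c := w k d) (fun n => iterate_vecStep_nonneg hT hb n k d)
    fun n => ?_
  have h1 := congrFun (congrFun (eq_sum_add_iterate_vecStep h n) k) d
  have h2 := iterate_vecStep_nonneg hT hw n k d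
  simp only [Pi.add_apply, Finset.sum_apply, Pi.zero_apply] at h1 h2
  linarith

/-- If `w = b + w T` for nonnegative vectors and every state is accessible from the support of `b`,
then the powers of `T` are summable. -/
theorem summable_blockPow (hT : ∀ i j, Nonneg (T i j)) (hz : ∀ j k, k + 2 ≤ j → T j k = 0)
    {b w : ℕ → Fin m → ℝ} (hb : ∀ i, 0 ≤ b i) (hw : ∀ i, 0 ≤ w i) (h : w = b + vecStep T w)
    (hreach : ∀ i a, ∃ n, 0 < (vecStep T)^[n] b i a) (i k : ℕ) :
    Summable (fun n => blockPow T n i k) := by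
  refine summable_matrix_iff.2 fun a d => ?_
  obtain ⟨n₀, h0⟩ := hreach i a
  -- If δ > 0 is the mass that b T^n₀ puts on (i, a), then δ times the (i, a), (k, d) entry of Tⁿ is
  -- at most that of b T^(n₀+n) at (k, d), which is summable in n.
  have hs := ((summable_nat_add_iff n₀).2 (summable_iterate_vecStep hT hb hw h k d)).mul_left
    ((vecStep T)^[n₀] b i a)⁻¹
  refine Summable.of_nonneg_of_le (fun n => blockPow_nonneg hT n i k a d) (fun n => ?_) hs
  rw [inv_mul_eq_div, le_div_iff₀ h0, mul_comm, Function.iterate_add_apply]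
  exact mul_blockPow_le hT hz (fun j => iterate_vecStep_nonneg hT hb n₀ j) n i k a d

/-- If `w = b + w T` and `w Tⁿ → 0`, then `w = b (I - T)⁻¹`. -/
theorem isVecMul_minInv (hT : ∀ i j, Nonneg (T i j)) (hz : ∀ j k, k + 2 ≤ j → T j k = 0)
    (hs : ∀ i k, Summable (fun n => blockPow T n i k))
    {b w : ℕ → Fin m → ℝ} (hb : ∀ i, 0 ≤ b i) (h : w = b + vecStep T w)
    (hlim : ∀ k, Tendsto (fun n => (vecStep T)^[n] w k) atTop (𝓝 0)) :
    IsVecMul b (minInv T) w := by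
  intro k
  have h1 : HasSum (fun n => (vecStep T)^[n] b k) (w k) := by
    refine Pi.hasSum.2 fun d => ?_
    rw [hasSum_iff_tendsto_nat_of_nonneg fun n => iterate_vecStep_nonneg hT hb n k d]
    have h2 := (tendsto_pi_nhds.1 (hlim k) d).const_sub (w k d)
    rw [Pi.zero_apply, sub_zero] at h2
    refine h2.congr fun n => ?_
    have h1 := congrFun (congrFun (eq_sum_add_iterate_vecStep h n) k) d
    simp only [Pi.add_apply, Finset.sum_apply] at h1
    linarith
  have h2 := (tonelli_vec (fun n i => Nonneg.vecMul (hb i) (blockPow_nonneg hT n i k))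
    (fun n => hasSum_vecMul_blockPow hz b n k) h1).2
  convert h2 using 2 with i
  exact (HasSum.const_vecMul (b i) (hs i k).hasSum).tsum_eq.symm

theorem blockPow_diagonal (d : ℕ → Matrix (Fin m) (Fin m) ℝ) (n i k : ℕ) :
    blockPow (Matrix.diagonal d) n i k = if i = k then d i ^ n else 0 := by
  induction n generalizing k with
  | zero => simp [blockPow, Matrix.one_apply]
  | succ n ih =>
    simp only [blockPow, ih]
    rw [tsum_eq_single i (fun j hj => by rw [if_neg hj.symm, zero_mul]), if_pos rfl,
      Matrix.diagonal_apply]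
    split_ifs with h
    · rw [pow_succ]
    · rw [mul_zero]

theorem summable_blockPow_diagonal {d : ℕ → Matrix (Fin m) (Fin m) ℝ}
    (h : ∀ i, Summable (fun n => d i ^ n)) (i k : ℕ) :
    Summable (fun n => blockPow (Matrix.diagonal d) n i k) := by
  simp only [blockPow_diagonal]
  split_ifs
  exacts [h i, summable_zero]

theorem minInv_diagonal (d : ℕ → Matrix (Fin m) (Fin m) ℝ) (i k : ℕ) :
    minInv (Matrix.diagonal d) i k = if i = k then ∑' n, d i ^ n else 0 := by
  simp only [minInv, blockPow_diagonal]
  split_ifs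
  exacts [rfl, tsum_zero]

theorem blockPow_eq_zero_of_strictUpper (h : ∀ i j, j ≤ i → T i j = 0) {n i k : ℕ}
    (hk : k < i + n) : blockPow T n i k = 0 := by
  induction n generalizing k with
  | zero => rw [blockPow, Matrix.one_apply, if_neg (by omega)]
  | succ n ih =>
    rw [blockPow]
    convert tsum_zero with j
    by_cases hj : k ≤ j
    · rw [h j k hj, mul_zero]
    · rw [ih (by omega), zero_mul]

theorem summable_blockPow_of_strictUpper (h : ∀ i j, j ≤ i → T i j = 0) (i k : ℕ) :
    Summable (fun n => blockPow T n i k) := by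
  refine summable_of_ne_finset_zero (s := Finset.range (k + 1)) fun n hn => ?_
  have : k + 1 ≤ n := by simpa using hn
  exact blockPow_eq_zero_of_strictUpper h (by omega)

/-- The powers of the block matrix with `G` on its subdiagonal and `0` elsewhere. -/
theorem blockPow_subdiagonal (G : Matrix (Fin m) (Fin m) ℝ) (n i k : ℕ) :
    blockPow (fun i j => if i = j + 1 then G else 0) n i k = if i = k + n then G ^ n else 0 := by
  induction n generalizing k with
  | zero => simp [blockPow, Matrix.one_apply]
  | succ n ih =>
    simp only [blockPow, ih]
    rw [tsum_eq_single (k + 1) (fun j hj => by rw [if_neg hj, mul_zero]), if_pos rfl, ite_mul,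
      zero_mul, ← pow_succ]
    congr 1
    rw [eq_iff_iff]; omega

theorem summable_blockPow_subdiagonal (G : Matrix (Fin m) (Fin m) ℝ) (i k : ℕ) :
    Summable (fun n => blockPow (fun i j => if i = j + 1 then G else 0) n i k) := by
  refine summable_of_ne_finset_zero (s := {i - k}) fun n hn => ?_
  rw [blockPow_subdiagonal, if_neg]
  rintro rfl
  simp at hn

theorem minInv_subdiagonal (G : Matrix (Fin m) (Fin m) ℝ) (i k : ℕ) :
    minInv (fun i j => if i = j + 1 then G else 0) i k = if k ≤ i then G ^ (i - k) else 0 := by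
  simp only [minInv, blockPow_subdiagonal]
  rw [tsum_eq_single (i - k)]
  · congr 1
    rw [eq_iff_iff]; omega
  · intro n hn
    rw [if_neg]; omega

end BlockPow

/-! ### Tails, the chain killed on level 0, and the equation for the tails -/

section Tails

variable {m : ℕ}

/-- The tails of a sequence of vectors. -/
def tails (y : ℕ → Fin m → ℝ) (k : ℕ) : Fin m → ℝ := ∑' j, y (k + j)

theorem hasSum_tails {y : ℕ → Fin m → ℝ} (hy : Summable y) (k : ℕ) :
    HasSum (fun j => y (k + j)) (tails y k) :=
  (hy.comp_injective (add_right_injective k)).hasSum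

theorem tails_eq_add {y : ℕ → Fin m → ℝ} (hy : Summable y) (k : ℕ) :
    tails y k = y k + tails y (k + 1) := by
  have h := (hasSum_nat_add_iff' 1).2 (hasSum_tails hy k)
  rw [Finset.sum_range_one, add_zero] at h
  have h2 := hasSum_tails hy (k + 1)
  simp only [add_assoc, add_comm 1] at h2
  rw [h2.unique h, add_sub_cancel]

theorem tails_nonneg {y : ℕ → Fin m → ℝ} (hy : Summable y) (h0 : ∀ i, 0 ≤ y i) (k : ℕ) :
    0 ≤ tails y k := fun a => (Pi.hasSum.1 (hasSum_tails hy k) a).nonneg fun j => h0 (k + j) a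

theorem tendsto_tails (y : ℕ → Fin m → ℝ) : Tendsto (tails y) atTop (𝓝 0) := by
  have h := _root_.tendsto_sum_nat_add y
  refine h.congr fun k => ?_
  simp only [tails, add_comm]

end Tails

namespace Blocks

variable {m₀ m : ℕ} {D : Blocks m₀ m}

theorem transition_inr_inr (i j : ℕ) (a b : Fin m) :
    D.transition (Sum.inr (i, a)) (Sum.inr (j, b)) =
      if i ≤ j + 1 then D.A (j + 1 - i) a b else 0 := by
  cases i <;> rfl

/-- The restriction of the transition matrix to the levels `≥ 1`. -/
def killed (D : Blocks m₀ m) : BlockMatrix m := fun i j =>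
  if i ≤ j + 1 then D.A (j + 1 - i) else 0

theorem killed_eq_zero (i j : ℕ) (h : j + 2 ≤ i) : D.killed i j = 0 := if_neg (by omega)

theorem transition_inr_inr' (i j : ℕ) (a b : Fin m) :
    D.transition (Sum.inr (i, a)) (Sum.inr (j, b)) = D.killed i j a b := by
  rw [transition_inr_inr, killed]
  split_ifs <;> rfl

theorem A_nonneg (h : IsStochastic D.transition) (k : ℕ) : Nonneg (D.A k) := fun a b => by
  simpa [transition_inr_inr] using h.1 (Sum.inr (1, a)) (Sum.inr (k, b))

theorem B_nonneg (h : IsStochastic D.transition) (k : ℕ) : Nonneg (D.B (k + 2)) := fun a b =>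
  h.1 (Sum.inl a) (Sum.inr (k, b))

theorem killed_nonneg (h : IsStochastic D.transition) (i j : ℕ) : Nonneg (D.killed i j) :=
  fun a b => transition_inr_inr' (D := D) i j a b ▸ h.1 _ _

theorem summable_A (h : IsStochastic D.transition) : Summable D.A :=
  summable_matrix_iff.2 fun a b => by
    have hi : Function.Injective fun k : ℕ => (Sum.inr (k, b) : State m₀ m) :=
      fun _ _ h => by simpa using h
    simpa [Function.comp_def, transition_inr_inr] using
      (h.2 (Sum.inr (1, a))).summable.comp_injective hi

theorem summable_B (h : IsStochastic D.transition) : Summable (fun k => D.B (k + 2)) :=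
  summable_matrix_iff.2 fun a b => by
    have hi : Function.Injective fun k : ℕ => (Sum.inr (k, b) : State m₀ m) :=
      fun _ _ h => by simpa using h
    exact (h.2 (Sum.inl a)).summable.comp_injective hi

theorem hasSum_killed_row (h : IsStochastic D.transition) (i : ℕ) (a : Fin m)
    (h0 : ∀ b, D.transition (Sum.inr (i, a)) (Sum.inl b) = 0) :
    HasSum (fun j => ∑ b, D.killed i j a b) 1 := by
  have h1 : HasSum (fun p : ℕ × Fin m => D.transition (Sum.inr (i, a)) (Sum.inr p)) 1 := by
    refine (Sum.inr_injective.hasSum_iff fun s hs => ?_).2 (h.2 (Sum.inr (i, a)))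
    cases s with
    | inl b => exact h0 b
    | inr p => exact absurd ⟨p, rfl⟩ hs
  refine h1.prod_fiberwise fun j => ?_
  simp only [transition_inr_inr']
  exact hasSum_fintype _

theorem hasSum_A_row (h : IsStochastic D.transition) (a : Fin m) :
    HasSum (fun k => ∑ b, D.A k a b) 1 := by
  simpa [killed] using hasSum_killed_row h 1 a fun b => rfl

/-- Without level 0, the rows of level 1 give A₁ + A₂ + ⋯ row sums 1, as those of level 2 do for A₀
+ A₁ + ⋯. So A₀ = 0 and the levels ≥ 2 are closed, against irreducibility. -/
theorem nonempty_levelZero (h : IsStochastic D.transition) (hirr : D.transition.IsIrreducible)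
    (a : Fin m) : Nonempty (Fin m₀) := by
  by_contra hne
  rw [not_nonempty_iff] at hne
  have hA : ∀ a b, D.A 0 a b = 0 := fun a b => by
    have h1 : HasSum (fun k => ∑ b, D.A (k + 1) a b) 1 := by
      simpa [killed] using hasSum_killed_row h 0 a fun b => hne.elim b
    have h2 := (hasSum_nat_add_iff' 1).2 (hasSum_A_row h a)
    rw [Finset.sum_range_one] at h2
    have h3 : ∑ b, D.A 0 a b = 0 := by linarith [h1.unique h2]
    exact (Finset.sum_eq_zero_iff_of_nonneg fun b _ => A_nonneg h 0 a b).1 h3 b (Finset.mem_univ b)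
  have := forall_of_isIrreducible hirr (fun s => ∃ i c, s = Sum.inr (i + 1, c)) ?_
    (i := Sum.inr (1, a)) ⟨0, a, rfl⟩ (Sum.inr (0, a))
  · simp at this
  · rintro s (b | ⟨j, c⟩) ⟨i, d, rfl⟩ hst
    · exact hne.elim b
    · cases j with
      | succ j => exact ⟨j, c, rfl⟩
      | zero =>
        rw [transition_inr_inr] at hst
        split_ifs at hst with hi
        · rw [show 0 + 1 - (i + 1) = 0 by omega, hA] at hst
          exact absurd hst (lt_irrefl _)
        · exact absurd hst (lt_irrefl _)

theorem hasSum_mul_transition_inr (w : State m₀ m → ℝ) (j : ℕ) (c : Fin m) :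
    HasSum (fun s => w s * D.transition s (Sum.inr (j, c)))
      ((levelZero w ᵥ* D.B (j + 2) + vecStep D.killed (levelSucc w) j) c) := by
  classical
  have h1 : (levelZero w ᵥ* D.B (j + 2) + vecStep D.killed (levelSucc w) j) c =
      ∑ s ∈ (Finset.univ : Finset (Fin m₀)).disjSum (Finset.range (j + 2) ×ˢ Finset.univ),
        w s * D.transition s (Sum.inr (j, c)) := by
    rw [Finset.sum_disjSum, Finset.sum_product, Pi.add_apply, vecStep, Finset.sum_apply]
    simp only [transition_inr_inr']
    rfl
  rw [h1]
  refine hasSum_sum_of_ne_finset_zero fun s hs => ?_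
  rcases s with a | ⟨i, a⟩
  · simp at hs
  · rw [transition_inr_inr', killed_eq_zero i j (by simpa using hs)]
    exact mul_zero _

theorem levelSucc_eq {x : State m₀ m → ℝ} (hx : IsStationary D.transition x) :
    levelSucc x = (fun k => levelZero x ᵥ* D.B (k + 2)) + vecStep D.killed (levelSucc x) := by
  funext k c
  exact (hx.2.2 _).unique (hasSum_mul_transition_inr x k c)

theorem levelSucc_nonneg {x : State m₀ m → ℝ} (hx : IsStationary D.transition x) (k : ℕ) :
    0 ≤ levelSucc x k := fun _ => hx.1 _

theorem levelZero_nonneg {x : State m₀ m → ℝ} (hx : IsStationary D.transition x) :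
    0 ≤ levelZero x := fun _ => hx.1 _

theorem summable_levelSucc {x : State m₀ m → ℝ} (hx : IsStationary D.transition x) :
    Summable (levelSucc x) :=
  Pi.summable.2 fun b => by
    have hi : Function.Injective fun k : ℕ => (Sum.inr (k, b) : State m₀ m) :=
      fun _ _ h => by simpa using h
    exact hx.2.1.summable.comp_injective hi

theorem stationary_pos {P : Matrix (State m₀ m) (State m₀ m) ℝ} (h : IsStochastic P)
    (hirr : P.IsIrreducible) {x : State m₀ m → ℝ} (hx : IsStationary P x) (s : State m₀ m) :
    0 < x s := by
  have hex : ∃ i, 0 < x i := by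
    by_contra hne
    push Not at hne
    have h0 : x = fun _ => 0 := funext fun i => le_antisymm (hne i) (hx.1 i)
    have h1 := hx.2.1
    rw [h0] at h1
    exact zero_ne_one (hasSum_zero.unique h1)
  obtain ⟨i, hi⟩ := hex
  exact pos_of_subinvariant hirr (fun i j => le_hasSum (hx.2.2 j) i fun k _ =>
    mul_nonneg (hx.1 k) (h.1 k j)) hi s

/-- The killed chain has no nonzero summable invariant vector. -/
theorem eq_zero_of_killed_invariant (h : IsStochastic D.transition)
    (hirr : D.transition.IsIrreducible) {z : ℕ → Fin m → ℝ} (hz : ∀ i, 0 ≤ z i)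
    (hs : Summable (fun p : ℕ × Fin m => z p.1 p.2)) (hinv : vecStep D.killed z = z) : z = 0 := by
  funext j c
  by_contra hne
  have hpos : 0 < z j c := lt_of_le_of_ne (hz j c) (Ne.symm hne)
  obtain ⟨a₀⟩ := nonempty_levelZero h hirr c
  -- Extended by 0, the vector satisfies w ≤ wP, with equality on the levels ≥ 1. It is then
  -- invariant, and positivity at one state would force positivity on level 0.
  let w : State m₀ m → ℝ := Sum.elim (fun _ => 0) fun p => z p.1 p.2
  have hw : ∀ s, 0 ≤ w s := by
    rintro (a | ⟨i, a⟩)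
    exacts [le_rfl, hz i a]
  have hws : Summable w := by
    have h0 : HasSum (w ∘ Sum.inl) 0 := hasSum_zero
    exact (HasSum.sum h0 hs.hasSum).summable
  have hP1 : ∀ s t, D.transition s t ≤ 1 := fun s t =>
    le_hasSum (h.2 s) t fun u _ => h.1 s u
  have hcol : ∀ t, HasSum (fun s => w s * D.transition s t) (∑' s, w s * D.transition s t) :=
    fun t => (Summable.of_nonneg_of_le (fun s => mul_nonneg (hw s) (h.1 s t))
      (fun s => mul_le_of_le_one_right (hw s) (hP1 s t)) hws).hasSum
  have hzero : levelZero w = 0 := rfl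
  have hsucc : levelSucc w = z := rfl
  have hle : ∀ t, w t ≤ ∑' s, w s * D.transition s t := by
    rintro (a | ⟨i, a⟩)
    · exact tsum_nonneg fun s => mul_nonneg (hw s) (h.1 s _)
    · rw [(hasSum_mul_transition_inr w i a).tsum_eq, hzero, hsucc, hinv, Matrix.zero_vecMul,
        zero_add]
      rfl
  have heq := invariant_of_le h hw hws hcol hle
  have hsub : ∀ s t, w s * D.transition s t ≤ w t := fun s t => by
    rw [← heq t]
    exact le_hasSum (hcol t) s fun u _ => mul_nonneg (hw u) (h.1 u t)
  have := pos_of_subinvariant hirr hsub (i := Sum.inr (j, c)) hpos (Sum.inl a₀)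
  exact lt_irrefl _ this

/-- With y = β + yQ, the vector yQⁿ equals y minus a partial sum of the convergent series ∑ βQⁱ. Its
limit z satisfies zQ = z and 0 ≤ z ≤ y, so it is summable and `eq_zero_of_killed_invariant` applies.
-/
theorem tendsto_iterate_killed (h : IsStochastic D.transition)
    (hirr : D.transition.IsIrreducible) {x : State m₀ m → ℝ} (hx : IsStationary D.transition x)
    (k : ℕ) : Tendsto (fun n => (vecStep D.killed)^[n] (levelSucc x) k) atTop (𝓝 0) := by
  have hβ : ∀ k, 0 ≤ levelZero x ᵥ* D.B (k + 2) := fun k =>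
    Nonneg.vecMul (levelZero_nonneg hx) (B_nonneg h k)
  have hs := summable_iterate_vecStep (killed_nonneg h) hβ (levelSucc_nonneg hx) (levelSucc_eq hx)
  have hdec := eq_sum_add_iterate_vecStep (levelSucc_eq hx)
  set β : ℕ → Fin m → ℝ := fun k => levelZero x ᵥ* D.B (k + 2) with hβdef
  let z : ℕ → Fin m → ℝ := fun k c =>
    levelSucc x k c - ∑' n, (vecStep D.killed)^[n] β k c
  have hlim : ∀ k, Tendsto (fun n => (vecStep D.killed)^[n] (levelSucc x) k) atTop (𝓝 (z k)) := by
    refine fun k => tendsto_pi_nhds.2 fun c => ?_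
    refine ((hs k c).hasSum.tendsto_sum_nat.const_sub (levelSucc x k c)).congr fun n => ?_
    have h1 := congrFun (congrFun (hdec n) k) c
    simp only [Pi.add_apply, Finset.sum_apply] at h1
    linarith
  have hz : ∀ i, 0 ≤ z i := fun i => ge_of_tendsto' (hlim i) fun n =>
    iterate_vecStep_nonneg (killed_nonneg h) (levelSucc_nonneg hx) n i
  have hzle : ∀ i c, z i c ≤ levelSucc x i c := fun i c =>
    sub_le_self _ (tsum_nonneg fun n => iterate_vecStep_nonneg (killed_nonneg h) hβ n i c)
  have hinv : vecStep D.killed z = z := by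
    funext k
    have h1 : Tendsto (fun n => (vecStep D.killed)^[n + 1] (levelSucc x) k) atTop
        (𝓝 (vecStep D.killed z k)) := by
      simp only [Function.iterate_succ_apply', vecStep]
      refine tendsto_finsetSum _ fun j _ => ?_
      exact ((continuous_id.matrix_vecMul continuous_const).tendsto (z j)).comp (hlim j)
    exact tendsto_nhds_unique h1 ((hlim k).comp (tendsto_add_atTop_nat 1))
  have hzs : Summable (fun p : ℕ × Fin m => z p.1 p.2) :=
    Summable.of_nonneg_of_le (fun p => hz p.1 p.2) (fun p => hzle p.1 p.2)
      (hx.2.1.summable.comp_injective Sum.inr_injective)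
  have h0 := eq_zero_of_killed_invariant h hirr hz hzs hinv
  have h1 := hlim k
  rwa [h0] at h1

theorem hasSum_ATail (h : IsStochastic D.transition) (k : ℕ) :
    HasSum (fun j => D.A (k + j)) (D.ATail k) :=
  ((summable_A h).comp_injective (add_right_injective k)).hasSum

theorem ATail_nonneg (h : IsStochastic D.transition) (k : ℕ) : Nonneg (D.ATail k) :=
  Nonneg.tsum fun _ => A_nonneg h _

theorem ATail_eq_add (h : IsStochastic D.transition) (k : ℕ) :
    D.ATail k = D.A k + D.ATail (k + 1) := by
  have h1 := (hasSum_nat_add_iff' 1).2 (hasSum_ATail h k)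
  rw [Finset.sum_range_one, add_zero] at h1
  have h2 := hasSum_ATail h (k + 1)
  simp only [add_assoc, add_comm 1] at h2
  rw [h2.unique h1, add_sub_cancel]

theorem tendsto_ATail : Tendsto D.ATail atTop (𝓝 0) := by
  refine (_root_.tendsto_sum_nat_add D.A).congr fun k => ?_
  simp only [ATail, add_comm]

theorem tailMatrix_nonneg (h : IsStochastic D.transition) (i j : ℕ) : Nonneg (D.tailMatrix i j) := by
  unfold tailMatrix
  split_ifs
  exacts [ATail_nonneg h _, A_nonneg h _, Nonneg.zero]

theorem tailMatrix_eq_zero (i j : ℕ) (h : j + 2 ≤ i) : D.tailMatrix i j = 0 := by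
  rw [tailMatrix, if_neg (by omega), if_neg (by omega)]

theorem tailMatrix_zero (j : ℕ) : D.tailMatrix 0 j = D.ATail (j + 1) := if_pos rfl

theorem tailMatrix_succ {i j : ℕ} (h : i ≤ j) : D.tailMatrix (i + 1) j = D.A (j - i) := by
  rw [tailMatrix, if_neg (by omega), if_pos (by omega)]
  congr 1; omega

theorem vecStep_tailMatrix (t : ℕ → Fin m → ℝ) (k : ℕ) :
    vecStep D.tailMatrix t k =
      ∑ i ∈ Finset.range (k + 1), t (i + 1) ᵥ* D.A (k - i) + t 0 ᵥ* D.ATail (k + 1) := by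
  rw [vecStep, Finset.sum_range_succ', tailMatrix_zero]
  congr 1
  refine Finset.sum_congr rfl fun i hi => ?_
  rw [tailMatrix_succ (by simpa [Nat.lt_succ_iff] using hi)]

theorem vecStep_killed (y : ℕ → Fin m → ℝ) (k : ℕ) :
    vecStep D.killed y k = ∑ i ∈ Finset.range (k + 2), y i ᵥ* D.A (k + 1 - i) := by
  refine Finset.sum_congr rfl fun i hi => ?_
  rw [killed, if_pos (by simpa [Nat.lt_succ_iff] using hi)]

/-- Taking tails intertwines the killed chain and the tail matrix. -/
theorem hasSum_vecStep_killed (h : IsStochastic D.transition) {y : ℕ → Fin m → ℝ}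
    (hy : Summable y) (h0 : ∀ i, 0 ≤ y i) (k : ℕ) :
    HasSum (fun j => vecStep D.killed y (k + j)) (vecStep D.tailMatrix (tails y) k) := by
  -- Summation by parts, from y_i = π_i - π_{i+1} and Ā_{k+1} = A_{k+1} + Ā_{k+2}. The series then
  -- telescopes, and `hlim` removes the term at infinity.
  have hdiff : ∀ k, vecStep D.killed y k =
      vecStep D.tailMatrix (tails y) k - vecStep D.tailMatrix (tails y) (k + 1) := fun k => by
    rw [vecStep_killed, vecStep_tailMatrix, vecStep_tailMatrix]
    have h1 : ∀ i, y i = tails y i - tails y (i + 1) := fun i => by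
      rw [tails_eq_add hy i, add_sub_cancel_right]
    simp only [h1, Matrix.sub_vecMul, Finset.sum_sub_distrib]
    rw [Finset.sum_range_succ' (fun i => tails y i ᵥ* D.A (k + 1 - i)),
      ATail_eq_add h (k + 1), Matrix.vecMul_add]
    simp only [Nat.add_sub_add_right, Nat.sub_zero]
    abel
  have hlim : Tendsto (vecStep D.tailMatrix (tails y)) atTop (𝓝 0) := by
    have h1 := tendsto_convolution_vecMul ((tendsto_tails y).comp (tendsto_add_atTop_nat 1))
      (summable_A h)
    have h2 : Tendsto (fun k => tails y 0 ᵥ* D.ATail (k + 1)) atTop (𝓝 0) := by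
      have h3 := ((continuous_const (y := tails y 0)).matrix_vecMul continuous_id).tendsto
        (0 : Matrix (Fin m) (Fin m) ℝ)
      simp only [id, Matrix.vecMul_zero] at h3
      exact h3.comp (tendsto_ATail.comp (tendsto_add_atTop_nat 1))
    have h4 := h1.add h2
    rw [add_zero] at h4
    exact h4.congr fun k => (vecStep_tailMatrix _ k).symm
  have hnn : ∀ j, 0 ≤ vecStep D.killed y j := fun j => Finset.sum_nonneg fun i _ =>
    Nonneg.vecMul (h0 i) (killed_nonneg h i j)
  refine Pi.hasSum.2 fun c => ?_
  rw [hasSum_iff_tendsto_nat_of_nonneg fun j => hnn (k + j) c]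
  have h1 := ((tendsto_pi_nhds.1 hlim c).comp (tendsto_add_atTop_nat k)).const_sub
    (vecStep D.tailMatrix (tails y) k c)
  rw [Pi.zero_apply, sub_zero] at h1
  refine h1.congr fun n => ?_
  have h2 := Finset.sum_range_sub' (fun j => vecStep D.tailMatrix (tails y) (k + j) c) n
  simp only [hdiff, Pi.sub_apply]
  rw [add_zero] at h2
  simp only [Function.comp_apply, add_comm n k]
  rw [← h2]
  rfl

theorem summable_vecStep_killed (h : IsStochastic D.transition) {y : ℕ → Fin m → ℝ}
    (hy : Summable y) (h0 : ∀ i, 0 ≤ y i) : Summable (vecStep D.killed y) := by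
  simpa using (hasSum_vecStep_killed h hy h0 0).summable

theorem iterate_killed (h : IsStochastic D.transition) {y : ℕ → Fin m → ℝ}
    (hy : Summable y) (h0 : ∀ i, 0 ≤ y i) (n : ℕ) :
    Summable ((vecStep D.killed)^[n] y) ∧
      tails ((vecStep D.killed)^[n] y) = (vecStep D.tailMatrix)^[n] (tails y) := by
  induction n with
  | zero => exact ⟨hy, rfl⟩
  | succ n ih =>
    have hn := iterate_vecStep_nonneg (killed_nonneg h) h0 n
    rw [Function.iterate_succ_apply', Function.iterate_succ_apply', ← ih.2]
    exact ⟨summable_vecStep_killed h ih.1 hn,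
      funext fun k => (hasSum_vecStep_killed h ih.1 hn k).tsum_eq⟩

theorem boundary_nonneg (h : IsStochastic D.transition) {x : State m₀ m → ℝ}
    (hx : IsStationary D.transition x) (k : ℕ) : 0 ≤ D.boundary x k :=
  Nonneg.vecMul (levelZero_nonneg hx) <| Nonneg.tsum fun j => by
    rw [add_right_comm]; exact B_nonneg h _

theorem hasSum_B (h : IsStochastic D.transition) (k : ℕ) :
    HasSum (fun j => D.B (k + 2 + j)) (∑' j, D.B (k + 2 + j)) := by
  simp only [add_right_comm k 2]
  exact ((summable_B h).comp_injective (add_right_injective k)).hasSum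

theorem tail_eq (h : IsStochastic D.transition) {x : State m₀ m → ℝ}
    (hx : IsStationary D.transition x) :
    tail x = D.boundary x + vecStep D.tailMatrix (tail x) := by
  funext k
  have h1 := HasSum.const_vecMul (levelZero x) (hasSum_B h k)
  simp only [add_right_comm k 2] at h1
  have h2 := h1.add (hasSum_vecStep_killed h (summable_levelSucc hx) (levelSucc_nonneg hx) k)
  have h3 : ∀ j, levelSucc x (k + j) = levelZero x ᵥ* D.B (k + j + 2) +
      vecStep D.killed (levelSucc x) (k + j) := fun j => congrFun (levelSucc_eq hx) (k + j)
  simp only [← h3] at h2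
  refine ((hasSum_tails (summable_levelSucc hx) k).unique h2).trans ?_
  simp only [← add_right_comm k 2]
  rfl

/-- By `iterate_killed` these vectors are the tails of yQⁿ, where yQⁿ ≤ y and yQⁿ → 0 in each
coordinate; dominated convergence passes to the tails. -/
theorem tendsto_iterate_tailMatrix (h : IsStochastic D.transition)
    (hirr : D.transition.IsIrreducible) {x : State m₀ m → ℝ} (hx : IsStationary D.transition x)
    (k : ℕ) : Tendsto (fun n => (vecStep D.tailMatrix)^[n] (tail x) k) atTop (𝓝 0) := by
  have hy := summable_levelSucc hx
  have hy0 := levelSucc_nonneg hx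
  have hdec := eq_sum_add_iterate_vecStep (levelSucc_eq hx)
  have hβ : ∀ k, 0 ≤ levelZero x ᵥ* D.B (k + 2) := fun k =>
    Nonneg.vecMul (levelZero_nonneg hx) (B_nonneg h k)
  refine tendsto_pi_nhds.2 fun c => ?_
  have key : Tendsto (fun n => ∑' j, (vecStep D.killed)^[n] (levelSucc x) (k + j) c) atTop
      (𝓝 (∑' _ : ℕ, (0 : ℝ))) := by
    refine tendsto_tsum_of_dominated_convergence
      (Pi.hasSum.1 (hasSum_tails hy k) c).summable
      (fun j => tendsto_pi_nhds.1 (tendsto_iterate_killed h hirr hx (k + j)) c)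
      (Eventually.of_forall fun n j => ?_)
    have h1 := congrFun (congrFun (hdec n) (k + j)) c
    have h2 := iterate_vecStep_nonneg (killed_nonneg h) hy0 n (k + j) c
    have h3 : 0 ≤ ∑ i ∈ Finset.range n, (vecStep D.killed)^[i]
        (fun k => levelZero x ᵥ* D.B (k + 2)) (k + j) c := Finset.sum_nonneg fun i _ =>
      iterate_vecStep_nonneg (killed_nonneg h) hβ i (k + j) c
    simp only [Pi.add_apply, Finset.sum_apply, Pi.zero_apply] at h1 h2
    rw [Real.norm_of_nonneg h2]
    linarith
  rw [tsum_zero] at key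
  refine key.congr fun n => ?_
  obtain ⟨h1, h2⟩ := iterate_killed h hy hy0 n
  rw [show (tail x) = tails (levelSucc x) from rfl, ← h2]
  exact (Pi.hasSum.1 (hasSum_tails h1 k) c).tsum_eq

theorem boundary_pos (h : IsStochastic D.transition) (hirr : D.transition.IsIrreducible)
    {x : State m₀ m → ℝ} (hx : IsStationary D.transition x) {n j : ℕ} (hj : j ≤ n)
    {a : Fin m₀} {c : Fin m} (hB : 0 < D.B (n + 2) a c) : 0 < D.boundary x j c := by
  have hBn : ∀ l, Nonneg (D.B (j + 2 + l)) := fun l => by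
    rw [add_right_comm]; exact B_nonneg h _
  have h1 : D.B (n + 2) a c ≤ (∑' l, D.B (j + 2 + l)) a c := by
    have h2 := le_hasSum (hasSum_matrix_iff.1 (hasSum_B h j) a c) (n - j) fun l _ => hBn l a c
    rwa [show j + 2 + (n - j) = n + 2 by omega] at h2
  refine (mul_pos (stationary_pos h hirr hx (Sum.inl a)) (hB.trans_le h1)).trans_le ?_
  exact Finset.single_le_sum (f := fun a => levelZero x a * (∑' l, D.B (j + 2 + l)) a c)
    (fun a _ => mul_nonneg (levelZero_nonneg hx a) (Nonneg.tsum hBn a c)) (Finset.mem_univ a)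

/-- Every state is accessible from the boundary vector under the tail matrix. -/
theorem exists_iterate_tailMatrix_pos (h : IsStochastic D.transition)
    (hirr : D.transition.IsIrreducible) {x : State m₀ m → ℝ} (hx : IsStationary D.transition x)
    (i : ℕ) (a : Fin m) : ∃ n, 0 < (vecStep D.tailMatrix)^[n] (D.boundary x) i a := by
  obtain ⟨a₀⟩ := nonempty_levelZero h hirr a
  -- The property is strengthened to all j ≤ n, because a tail charges all levels below a charged
  -- one; the induction needs this to choose its starting row.
  refine forall_of_isIrreducible hirr (fun s => ∀ n c, s = Sum.inr (n, c) → ∀ j ≤ n,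
    ∃ N, 0 < (vecStep D.tailMatrix)^[N] (D.boundary x) j c) ?_ (i := Sum.inl a₀) (by simp)
    (Sum.inr (i, a)) i a rfl i le_rfl
  rintro s t hs hst n c rfl j hj
  rcases s with b | ⟨l, d⟩
  · exact ⟨0, boundary_pos h hirr hx hj hst⟩
  · have hstep : ∀ k ≤ l, 0 < D.tailMatrix k j d c →
        ∃ N, 0 < (vecStep D.tailMatrix)^[N] (D.boundary x) j c := fun k hk hpos => by
      obtain ⟨N, hN⟩ := hs l d rfl k hk
      exact ⟨N + 1, iterate_vecStep_succ_pos (tailMatrix_nonneg h) tailMatrix_eq_zero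
        (boundary_nonneg h hx) hN hpos⟩
    rw [transition_inr_inr] at hst
    split_ifs at hst with hl
    -- The block A_{n+1-l} of the original transition must occur in column j. If j + l ≤ n, it is a
    -- summand of Ā_{j+1} in row 0; otherwise it is the block of row j + l - n, a positive index
    -- that is at most l.
    · by_cases hjn : j + l ≤ n
      · refine hstep 0 (Nat.zero_le _) ?_
        rw [tailMatrix_zero]
        refine hst.trans_le ?_
        have h2 := le_hasSum (hasSum_matrix_iff.1 (hasSum_ATail h (j + 1)) d c) (n - l - j)
          fun i _ => A_nonneg h _ d c
        rwa [show j + 1 + (n - l - j) = n + 1 - l by omega] at h2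
      · refine hstep (j + l - n) (by omega) ?_
        obtain ⟨i, hi⟩ : ∃ i, j + l - n = i + 1 := ⟨j + l - n - 1, by omega⟩
        rw [hi, tailMatrix_succ (by omega), show j - i = n + 1 - l by omega]
        exact hst
    · exact absurd hst (lt_irrefl _)

theorem summable_blockPow_tailMatrix (h : IsStochastic D.transition)
    (hirr : D.transition.IsIrreducible) {x : State m₀ m → ℝ} (hx : IsStationary D.transition x)
    (i k : ℕ) : Summable (fun n => blockPow D.tailMatrix n i k) :=
  summable_blockPow (tailMatrix_nonneg h) tailMatrix_eq_zero (boundary_nonneg h hx)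
    (tails_nonneg (summable_levelSucc hx) (levelSucc_nonneg hx)) (tail_eq h hx)
    (exists_iterate_tailMatrix_pos h hirr hx) i k

end Blocks

/-! ### Neumann series of nonnegative matrices -/

section Geometric

variable {m : ℕ}

theorem Nonneg.pow_sub {H G : Matrix (Fin m) (Fin m) ℝ} (hH : Nonneg H) (hHG : Nonneg (G - H))
    (k : ℕ) : Nonneg (G ^ k - H ^ k) := by
  have hG : Nonneg G := by simpa using hHG.add hH
  induction k with
  | zero => simpa using Nonneg.zero
  | succ k ih =>
    have : G ^ (k + 1) - H ^ (k + 1) = G ^ k * (G - H) + (G ^ k - H ^ k) * H := by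
      rw [pow_succ, pow_succ, mul_sub, sub_mul]; abel
    rw [this]
    exact ((hG.pow k).mul hHG).add (ih.mul hH)

/-- The Neumann series of `M ≥ 0` converges if some `N ≥ 0` satisfies `N ≥ 1 + M N`. -/
theorem summable_pow_of_super {M N : Matrix (Fin m) (Fin m) ℝ} (hM : Nonneg M) (hN : Nonneg N)
    (h : Nonneg (N - 1 - M * N)) : Summable (fun n => M ^ n) := by
  -- Partial sums S_n stay below N, since N - S_{n+1} = (N - 1 - MN) + M(N - S_n).
  have hle : ∀ n, Nonneg (N - ∑ i ∈ Finset.range n, M ^ i) := fun n => by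
    induction n with
    | zero => simpa using hN
    | succ n ih =>
      have : N - ∑ i ∈ Finset.range (n + 1), M ^ i =
          (N - 1 - M * N) + M * (N - ∑ i ∈ Finset.range n, M ^ i) := by
        rw [Finset.sum_range_succ', mul_sub, Finset.mul_sum]
        simp only [← pow_succ', pow_zero]
        abel
      rw [this]
      exact h.add (hM.mul ih)
  refine summable_matrix_iff.2 fun a b =>
    summable_of_sum_range_le (c := N a b) (fun n => hM.pow n a b) fun n => ?_
  have := hle n a b
  rw [Matrix.sub_apply, Matrix.sum_apply] at this
  linarith

theorem inv_one_sub {M : Matrix (Fin m) (Fin m) ℝ} (h : Summable (fun n => M ^ n)) :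
    (1 - M)⁻¹ = ∑' n, M ^ n :=
  Matrix.inv_eq_right_inv h.one_sub_mul_tsum_pow

theorem isUnit_one_sub {M : Matrix (Fin m) (Fin m) ℝ} (h : Summable (fun n => M ^ n)) :
    IsUnit (1 - M) :=
  ⟨⟨1 - M, ∑' n, M ^ n, h.one_sub_mul_tsum_pow, h.tsum_pow_mul_one_sub⟩, rfl⟩

end Geometric

/-! ### The minimal solution `G`, comparison estimates, and the vector factorization -/

namespace Blocks

variable {m₀ m : ℕ} {D : Blocks m₀ m} {G : Matrix (Fin m) (Fin m) ℝ} {p : Type*}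

/-- The iterates of `H ↦ ∑ A_k Hᵏ` from `0`. -/
def iterG (D : Blocks m₀ m) : ℕ → Matrix (Fin m) (Fin m) ℝ
  | 0 => 0
  | n + 1 => ∑' k, D.A k * iterG D n ^ k

theorem iterG_nonneg (hA : ∀ k, Nonneg (D.A k)) (n : ℕ) : Nonneg (D.iterG n) := by
  induction n with
  | zero => exact Nonneg.zero
  | succ n ih => exact Nonneg.tsum fun k => (hA k).mul (ih.pow k)

theorem hasSum_A_mul_pow (hA : ∀ k, Nonneg (D.A k)) (hG : HasSum (fun k => D.A k * G ^ k) G)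
    {H : Matrix (Fin m) (Fin m) ℝ} (hH : Nonneg H) (hHG : Nonneg (G - H)) :
    HasSum (fun k => D.A k * H ^ k) (∑' k, D.A k * H ^ k) :=
  (Nonneg.summable (fun k => (hA k).mul (hH.pow k)) (fun k => by
    rw [← mul_sub]; exact (hA k).mul (hH.pow_sub hHG k)) hG.summable).hasSum

theorem sub_iterG_nonneg (hA : ∀ k, Nonneg (D.A k)) (hG : HasSum (fun k => D.A k * G ^ k) G)
    (hG0 : Nonneg G) (n : ℕ) : Nonneg (G - D.iterG n) := by
  induction n with
  | zero => simpa [iterG] using hG0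
  | succ n ih =>
    refine Nonneg.of_hasSum (fun k => ?_)
      (hG.sub (hasSum_A_mul_pow hA hG (iterG_nonneg hA n) ih))
    rw [← mul_sub]
    exact (hA k).mul ((iterG_nonneg hA n).pow_sub ih k)

theorem iterG_succ_sub_nonneg (hA : ∀ k, Nonneg (D.A k)) (hG : HasSum (fun k => D.A k * G ^ k) G)
    (hG0 : Nonneg G) (n : ℕ) : Nonneg (D.iterG (n + 1) - D.iterG n) := by
  induction n with
  | zero => simpa [iterG] using iterG_nonneg hA 1
  | succ n ih =>
    refine Nonneg.of_hasSum (fun k => ?_)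
      ((hasSum_A_mul_pow hA hG (iterG_nonneg hA (n + 1)) (sub_iterG_nonneg hA hG hG0 _)).sub
        (hasSum_A_mul_pow hA hG (iterG_nonneg hA n) (sub_iterG_nonneg hA hG hG0 _)))
    rw [← mul_sub]
    exact (hA k).mul ((iterG_nonneg hA n).pow_sub ih k)

/-- The iterates converge to the minimal nonnegative solution. -/
theorem tendsto_iterG (hA : ∀ k, Nonneg (D.A k)) (hG : D.IsMinimalSolution G) :
    Tendsto D.iterG atTop (𝓝 G) := by
  obtain ⟨hG0, hGs, hmin⟩ := hG
  have hle := sub_iterG_nonneg hA hGs hG0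
  have hmono : ∀ a b, Monotone fun n => D.iterG n a b := fun a b =>
    monotone_nat_of_le_succ fun n => sub_nonneg.1 (iterG_succ_sub_nonneg hA hGs hG0 n a b)
  have hbdd : ∀ a b, BddAbove (Set.range fun n => D.iterG n a b) := fun a b =>
    ⟨G a b, by rintro _ ⟨n, rfl⟩; exact sub_nonneg.1 (hle n a b)⟩
  let H : Matrix (Fin m) (Fin m) ℝ := fun a b => ⨆ n, D.iterG n a b
  have hH : Tendsto D.iterG atTop (𝓝 H) := tendsto_matrix_iff.2 fun a b =>
    tendsto_atTop_ciSup (hmono a b) (hbdd a b)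
  have hH0 : Nonneg H := Nonneg.of_tendsto (iterG_nonneg hA) hH
  have hHG : Nonneg (G - H) := Nonneg.of_tendsto hle (tendsto_const_nhds.sub hH)
  have hHs := hasSum_A_mul_pow hA hGs hH0 hHG
  -- Passing to the limit in the iteration, dominated by A_k Gᵏ, shows that H solves the equation;
  -- then minimality gives G ≤ H.
  have hfix : ∑' k, D.A k * H ^ k = H := by
    refine tendsto_nhds_unique ?_ (hH.comp (tendsto_add_atTop_nat 1))
    refine tendsto_matrix_iff.2 fun a b => ?_
    rw [tsum_matrix_apply hHs.summable]
    have key : Tendsto (fun n => ∑' k, (D.A k * D.iterG n ^ k) a b) atTop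
        (𝓝 (∑' k, (D.A k * H ^ k) a b)) := by
      refine tendsto_tsum_of_dominated_convergence (summable_matrix_iff.1 hGs.summable a b)
        (fun k => ?_) (Eventually.of_forall fun n k => ?_)
      · exact tendsto_matrix_iff.1 ((hH.pow k).const_mul (D.A k)) a b
      · rw [Real.norm_of_nonneg ((hA k).mul ((iterG_nonneg hA n).pow k) a b)]
        have := (hA k).mul ((iterG_nonneg hA n).pow_sub (hle n) k) a b
        rw [mul_sub, Matrix.sub_apply] at this
        exact sub_nonneg.1 this
    refine key.congr fun n => ?_
    exact (tsum_matrix_apply (hasSum_A_mul_pow hA hGs (iterG_nonneg hA n) (hle n)).summable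
      a b).symm
  rw [hfix] at hHs
  have hGH := hmin H hH0 hHs
  have : H = G := by
    ext a b
    exact le_antisymm (sub_nonneg.1 (hHG a b)) (hGH a b)
  rwa [this] at hH

/-- A nonnegative sequence with `∑ A_l N_{j+l} ≤ N_{j+1}` satisfies `Gᵏ N_j ≤ N_{j+k}`. -/
theorem pow_mul_le_of_super (hA : ∀ k, Nonneg (D.A k)) (hG : D.IsMinimalSolution G)
    {N : ℕ → Matrix (Fin m) p ℝ} (hN : ∀ j, Nonneg (N j))
    (hsuper : ∀ j, ∃ S, HasSum (fun l => D.A l * N (j + l)) S ∧ Nonneg (N (j + 1) - S))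
    (k j : ℕ) : Nonneg (N (j + k) - G ^ k * N j) := by
  -- Proved for the iterates G_n first: G_{n+1}N_j = ∑ A_l G_nˡ N_j ≤ ∑ A_l N_{j+l} ≤ N_{j+1}, and
  -- powers follow by induction on k.
  have key : ∀ n k j, Nonneg (N (j + k) - D.iterG n ^ k * N j) := fun n => by
    induction n with
    | zero =>
      rintro (_ | k) j
      · simpa using Nonneg.zero
      · simpa [iterG] using hN _
    | succ n ih =>
      have h1 : ∀ j, Nonneg (N (j + 1) - D.iterG (n + 1) * N j) := fun j => by
        obtain ⟨S, hS, hle⟩ := hsuper j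
        refine Nonneg.sub_trans ?_ hle
        refine Nonneg.of_hasSum (fun l => ?_) (hS.sub (HasSum.mulMatrix_const (N j)
          (hasSum_A_mul_pow hA hG.2.1 (iterG_nonneg hA n)
            (sub_iterG_nonneg hA hG.2.1 hG.1 n))))
        rw [Matrix.mul_assoc, ← Matrix.mul_sub]
        exact (hA l).mul (ih l j)
      intro k j
      induction k with
      | zero => simpa using Nonneg.zero
      | succ k ihk =>
        refine Nonneg.sub_trans ?_ (h1 (j + k))
        rw [pow_succ', Matrix.mul_assoc, ← Matrix.mul_sub]
        exact (iterG_nonneg hA _).mul ihk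
  refine Nonneg.of_tendsto (l := atTop) (fun n => key n k j) (tendsto_const_nhds.sub ?_)
  have hc : Continuous fun H : Matrix (Fin m) (Fin m) ℝ => H ^ k * N j :=
    (continuous_pow k).matrix_mul continuous_const
  exact (hc.tendsto G).comp (tendsto_iterG hA hG)

/-- The constant sequence of columns of ones meets the comparison hypothesis with equality, so the
row sums of Gᵏ are at most 1. -/
theorem G_pow_le_one (h : IsStochastic D.transition) (hG : D.IsMinimalSolution G) (k : ℕ)
    (a b : Fin m) : (G ^ k) a b ≤ 1 := by
  let J : Matrix (Fin m) Unit ℝ := Matrix.of fun _ _ => 1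
  have hJ : Nonneg J := fun _ _ => zero_le_one
  have hmul : ∀ (M : Matrix (Fin m) (Fin m) ℝ) a u, (M * J) a u = ∑ c, M a c := fun M a u => by
    simp [Matrix.mul_apply, J]
  have hs : HasSum (fun l => D.A l * J) J := hasSum_matrix_iff.2 fun a u => by
    simp only [hmul]
    exact hasSum_A_row h a
  have h1 := pow_mul_le_of_super (A_nonneg h) hG (N := fun _ => J) (fun _ => hJ)
    (fun _ => ⟨J, hs, by rw [sub_self]; exact Nonneg.zero⟩) k 0 a ()
  rw [Matrix.sub_apply, sub_nonneg, hmul] at h1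
  have hG0 : Nonneg G := hG.1
  exact (Finset.single_le_sum (f := fun b => (G ^ k) a b) (fun c _ => hG0.pow k a c)
    (Finset.mem_univ b)).trans h1

theorem summable_mul_G_pow (h : IsStochastic D.transition) (hG : D.IsMinimalSolution G)
    {C : ℕ → Matrix p (Fin m) ℝ} (hC : ∀ k, Nonneg (C k)) (hs : Summable C) :
    Summable (fun k => C k * G ^ k) := by
  have hG0 : Nonneg G := hG.1
  let J : Matrix (Fin m) (Fin m) ℝ := fun _ _ => 1
  refine Nonneg.summable (g := fun k => C k * J) (fun k => (hC k).mul (hG0.pow k)) (fun k => ?_)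
    (HasSum.mulMatrix_const J hs.hasSum).summable
  rw [← Matrix.mul_sub]
  exact (hC k).mul fun a b => sub_nonneg.2 (G_pow_le_one h hG k a b)

theorem summable_A_mul_pow (h : IsStochastic D.transition) (hG : D.IsMinimalSolution G) (j : ℕ) :
    Summable (fun k => D.A (j + k) * G ^ k) :=
  summable_mul_G_pow h hG (fun k => A_nonneg h (j + k)) (hasSum_ATail h j).summable

theorem summable_B_mul_pow (h : IsStochastic D.transition) (hG : D.IsMinimalSolution G) (j : ℕ) :
    Summable (fun k => D.B (j + 2 + k) * G ^ k) :=
  summable_mul_G_pow h hG (fun k => by rw [add_right_comm]; exact B_nonneg h (j + k))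
    (hasSum_B h j).summable

/-- The sequence `∑ₗ C_{k+l} Gˡ`. -/
def powSum (C : ℕ → Matrix p (Fin m) ℝ) (G : Matrix (Fin m) (Fin m) ℝ) (k : ℕ) :
    Matrix p (Fin m) ℝ := ∑' l, C (k + l) * G ^ l

theorem powSum_eq_add {C : ℕ → Matrix p (Fin m) ℝ}
    (hC : ∀ k, Summable (fun l => C (k + l) * G ^ l)) (k : ℕ) :
    powSum C G k = C k + powSum C G (k + 1) * G := by
  have h1 := (hasSum_nat_add_iff' 1).2 (hC k).hasSum
  have h2 := HasSum.mulMatrix_const G (hC (k + 1)).hasSum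
  simp only [Matrix.mul_assoc, ← pow_succ] at h2
  simp only [Finset.sum_range_one, add_zero, pow_zero, Matrix.mul_one, ← add_assoc,
    add_right_comm k _ 1] at h1
  rw [powSum, powSum, h2.unique h1, add_sub_cancel]

theorem powSum_nonneg {C : ℕ → Matrix p (Fin m) ℝ} (hC : ∀ k, Nonneg (C k)) (hG : Nonneg G)
    (k : ℕ) : Nonneg (powSum C G k) :=
  Nonneg.tsum fun l => (hC (k + l)).mul (hG.pow l)

theorem Psi_eq : D.Psi G = powSum (fun k => D.A (k + 1)) G 0 := by
  simp only [Psi, powSum, zero_add]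

theorem Psi_nonneg (hA : ∀ k, Nonneg (D.A k)) (hG : Nonneg G) : Nonneg (D.Psi G) :=
  Nonneg.tsum fun k => (hA (k + 1)).mul (hG.pow k)

theorem summable_A_succ_mul_pow (h : IsStochastic D.transition) (hG : D.IsMinimalSolution G)
    (k : ℕ) : Summable (fun l => D.A (k + l + 1) * G ^ l) := by
  simpa only [add_right_comm k 1] using summable_A_mul_pow h hG (k + 1)

/-- `(I - Ψ) G = A₀`. -/
theorem one_sub_Psi_mul (h : IsStochastic D.transition) (hG : D.IsMinimalSolution G) :
    (1 - D.Psi G) * G = D.A 0 := by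
  have h1 := (hasSum_nat_add_iff' 1).2 hG.2.1
  have h2 := HasSum.mulMatrix_const G (summable_A_succ_mul_pow h hG 0).hasSum
  simp only [Matrix.mul_assoc, ← pow_succ, zero_add] at h2
  rw [Finset.sum_range_one, pow_zero, mul_one] at h1
  rw [sub_mul, one_mul, Psi, h2.unique h1, sub_sub_cancel]

theorem hasSum_A_mul_minInv (h : IsStochastic D.transition)
    (hs : ∀ i k, Summable (fun n => blockPow D.tailMatrix n i k)) (j k : ℕ) :
    HasSum (fun l => D.A l * minInv D.tailMatrix (j + l) k)
      (minInv D.tailMatrix (j + 1) k - (1 : BlockMatrix m) (j + 1) k) := by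
  have h1 := hasSum_mul_minInv (tailMatrix_nonneg h) tailMatrix_eq_zero hs (j + 1) k
  rw [← (add_right_injective j).hasSum_iff] at h1
  · convert h1 using 2 with l
    simp only [Function.comp_apply]
    rw [tailMatrix_succ (Nat.le_add_right j l), Nat.add_sub_cancel_left]
  · intro i hi
    have : ¬ j ≤ i := fun hji => hi ⟨i - j, Nat.add_sub_cancel' hji⟩
    rw [tailMatrix, if_neg (by omega), if_neg (by omega), zero_mul]

theorem one_apply_nonneg (i k : ℕ) : Nonneg ((1 : BlockMatrix m) i k) := by
  rw [Matrix.one_apply]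
  split_ifs
  exacts [Nonneg.one, Nonneg.zero]

theorem pow_mul_minInv_le (h : IsStochastic D.transition) (hG : D.IsMinimalSolution G)
    (hs : ∀ i k, Summable (fun n => blockPow D.tailMatrix n i k)) (i j k : ℕ) :
    Nonneg (minInv D.tailMatrix (j + i) k - G ^ i * minInv D.tailMatrix j k) :=
  pow_mul_le_of_super (A_nonneg h) hG (N := fun j => minInv D.tailMatrix j k)
    (fun j => minInv_nonneg (tailMatrix_nonneg h) j k)
    (fun j => ⟨_, hasSum_A_mul_minInv h hs j k, by
      rw [sub_sub_cancel]; exact one_apply_nonneg _ _⟩) i j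

/-- For N = ∑ **P**ⁿ, row 1 reads N₁₁ = I + ∑ A_l N_{l,1}. Dropping l = 0 and using N_{l,1} ≥
G^{l-1}N₁₁ gives N₁₁ ≥ I + ΨN₁₁. -/
theorem summable_Psi_pow (h : IsStochastic D.transition) (hG : D.IsMinimalSolution G)
    (hs : ∀ i k, Summable (fun n => blockPow D.tailMatrix n i k)) :
    Summable (fun n => D.Psi G ^ n) := by
  have hN := minInv_nonneg (tailMatrix_nonneg h)
  refine summable_pow_of_super (Psi_nonneg (A_nonneg h) hG.1) (hN 1 1) ?_
  have h1 := (hasSum_nat_add_iff' 1).2 (hasSum_A_mul_minInv h hs 0 1)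
  rw [Finset.sum_range_one, Matrix.one_apply_eq] at h1
  have h2 := HasSum.mulMatrix_const (minInv D.tailMatrix 1 1)
    (summable_A_succ_mul_pow h hG 0).hasSum
  have h3 := Nonneg.of_hasSum (fun l => ?_) (h1.sub h2)
  · have h4 := h3.add ((A_nonneg h 0).mul (hN 0 1))
    convert h4 using 1
    simp only [Psi, zero_add, add_zero]
    abel
  · rw [Matrix.mul_assoc, zero_add, zero_add, add_comm l 1, ← Matrix.mul_sub]
    exact (A_nonneg h _).mul (pow_mul_minInv_le h hG hs l 1 1)

/-- The analogue for row 0, where convergence itself is at stake: bounded Gˡ would require ∑ Ā_l <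
∞. Instead N₀₀ ≥ I gives Ā_{l+1}Gˡ ≤ Ā_{l+1}GˡN₀₀ ≤ Ā_{l+1}N_{l,0}, which is summable. -/
theorem ATail_summable_and_super (h : IsStochastic D.transition) (hG : D.IsMinimalSolution G)
    (hs : ∀ i k, Summable (fun n => blockPow D.tailMatrix n i k)) :
    Summable (fun l => D.ATail (l + 1) * G ^ l) ∧
      Nonneg (minInv D.tailMatrix 0 0 - 1 -
        (∑' l, D.ATail (l + 1) * G ^ l) * minInv D.tailMatrix 0 0) := by
  have hG0 : Nonneg G := hG.1
  have h1 := hasSum_mul_minInv (tailMatrix_nonneg h) tailMatrix_eq_zero hs 0 0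
  simp only [tailMatrix_zero, Matrix.one_apply_eq] at h1
  have hN1 : Nonneg (minInv D.tailMatrix 0 0 - 1) := Nonneg.of_hasSum
    (fun j => (ATail_nonneg h _).mul (minInv_nonneg (tailMatrix_nonneg h) j 0)) h1
  have hle : ∀ l, Nonneg (D.ATail (l + 1) * minInv D.tailMatrix l 0 -
      D.ATail (l + 1) * G ^ l * minInv D.tailMatrix 0 0) := fun l => by
    rw [Matrix.mul_assoc, ← Matrix.mul_sub]
    have := pow_mul_minInv_le h hG hs l 0 0
    rw [zero_add] at this
    exact (ATail_nonneg h _).mul this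
  have hnn : ∀ l, Nonneg (D.ATail (l + 1) * G ^ l) := fun l =>
    (ATail_nonneg h _).mul (hG0.pow l)
  have hsum : Summable (fun l => D.ATail (l + 1) * G ^ l) := by
    refine Nonneg.summable hnn (fun l => ?_) h1.summable
    refine Nonneg.sub_trans ?_ (hle l)
    have := (hnn l).mul hN1
    rwa [mul_sub, mul_one] at this
  exact ⟨hsum, Nonneg.of_hasSum hle (h1.sub (HasSum.mulMatrix_const _ hsum.hasSum))⟩

theorem ATail_sub_nonneg (h : IsStochastic D.transition) (j k : ℕ) :
    Nonneg (D.ATail k - D.ATail (j + k)) := by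
  induction j with
  | zero => simpa using Nonneg.zero
  | succ j ih =>
    refine Nonneg.sub_trans ?_ ih
    rw [ATail_eq_add h (j + k), add_right_comm, add_sub_cancel_right]
    exact A_nonneg h _

theorem summable_ATail_mul_pow (h : IsStochastic D.transition) (hG0 : Nonneg G)
    (hs : Summable (fun l => D.ATail (l + 1) * G ^ l)) (k : ℕ) :
    Summable (fun l => D.ATail (k + l + 1) * G ^ l) :=
  Nonneg.summable (fun l => (ATail_nonneg h _).mul (hG0.pow l)) (fun l => by
    rw [← sub_mul, add_assoc]
    exact (ATail_sub_nonneg h k (l + 1)).mul (hG0.pow l)) hs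

/-- Up to the factor (I - Ψ)⁻¹, this identifies the R̂_{0,k} with tails of the R_j and yields the
summability of the latter. -/
theorem hasSum_powSum_A (h : IsStochastic D.transition) (hG0 : Nonneg G)
    (hs : Summable (fun l => D.ATail (l + 1) * G ^ l)) (k : ℕ) :
    HasSum (fun j => powSum (fun k => D.A (k + 1)) G (k + j))
      (powSum (fun k => D.ATail (k + 1)) G k) := by
  have h1 := (tonelli_matrix (f := fun l j => D.A (k + l + 1 + j) * G ^ l)
    (fun l j => (A_nonneg h _).mul (hG0.pow l))
    (fun l => HasSum.mulMatrix_const (G ^ l) (hasSum_ATail h (k + l + 1)))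
    (summable_ATail_mul_pow h hG0 hs k).hasSum).2
  convert h1 using 2 with j
  swap
  · rfl
  refine tsum_congr fun l => ?_
  change D.A (k + j + l + 1) * G ^ l = _
  rw [show k + j + l + 1 = k + l + 1 + j by omega]

/-- The factorization of the equation `y = β + y T`, where `T` has first row `C₀, C₁, …` and the
rows of a matrix of M/G/1 type below. -/
theorem hasSum_mul_pow_of_eq (h : IsStochastic D.transition) (hG : D.IsMinimalSolution G)
    {C E R : ℕ → Matrix (Fin m) (Fin m) ℝ} (hE : ∀ k, E k = C k + E (k + 1) * G)
    (hR : ∀ k, R k = D.A (k + 1) + R (k + 1) * G) (hR0 : R 0 = D.Psi G)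
    (hElim : Tendsto E atTop (𝓝 0)) (hRs : Summable R) {β y : ℕ → Fin m → ℝ}
    (hβ : ∀ k, 0 ≤ β k) (hylim : Tendsto y atTop (𝓝 0))
    (hy : ∀ k, y k = β k +
      (∑ i ∈ Finset.range (k + 1), y (i + 1) ᵥ* D.A (k - i) + y 0 ᵥ* C k)) (k : ℕ) :
    HasSum (fun n => β (k + n) ᵥ* G ^ n)
      (y k - y 0 ᵥ* E k - ∑ i ∈ Finset.range k, y (i + 1) ᵥ* R (k - 1 - i)) := by
  have hG0 : Nonneg G := hG.1
  -- This is y(I - R_U)(I - Ψ_D) without inverses: multiplication by I - Ψ_D has cancelled those in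
  -- R_U, and the diagonal terms have joined the sums.
  let u : ℕ → Fin m → ℝ := fun k =>
    y k - y 0 ᵥ* E k - ∑ i ∈ Finset.range k, y (i + 1) ᵥ* R (k - 1 - i)
  -- With A₀ = G - ΨG, the top term y_{k+1}A₀ becomes y_{k+1}G minus a term that completes the
  -- convolution in u_{k+1}G.
  have hA0 : D.A 0 = G - R 0 * G := by
    rw [hR0, ← one_sub_Psi_mul h hG, sub_mul, one_mul]
  have hrec : ∀ k, u k = β k + u (k + 1) ᵥ* G := fun k => by
    have hR' : ∀ i ∈ Finset.range k, y (i + 1) ᵥ* R (k - 1 - i) =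
        y (i + 1) ᵥ* D.A (k - i) + (y (i + 1) ᵥ* R (k - i)) ᵥ* G := fun i hi => by
      rw [Finset.mem_range] at hi
      rw [hR (k - 1 - i), show k - 1 - i + 1 = k - i by omega, Matrix.vecMul_add,
        Matrix.vecMul_vecMul]
    have hyk := hy k
    rw [Finset.sum_range_succ, Nat.sub_self, hA0, Matrix.vecMul_sub] at hyk
    have hβk : β k = y k - (∑ i ∈ Finset.range k, y (i + 1) ᵥ* D.A (k - i) +
        (y (k + 1) ᵥ* G - y (k + 1) ᵥ* (R 0 * G)) + y 0 ᵥ* C k) := eq_sub_of_add_eq hyk.symm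
    simp only [u]
    rw [Finset.sum_congr rfl hR', Finset.sum_add_distrib, hE k, hβk,
      Nat.add_sub_cancel, Matrix.sub_vecMul, Matrix.sub_vecMul, Finset.sum_range_succ,
      Matrix.add_vecMul, Matrix.sum_vecMul, Nat.sub_self, Matrix.vecMul_add,
      Matrix.vecMul_vecMul, Matrix.vecMul_vecMul]
    abel
  have hulim : Tendsto u atTop (𝓝 0) := by
    rw [← tendsto_add_atTop_iff_nat 1]
    have hy1 := hylim.comp (tendsto_add_atTop_nat 1)
    have h1 := tendsto_convolution_vecMul hy1 hRs
    have h2 : Tendsto (fun k => y 0 ᵥ* E (k + 1)) atTop (𝓝 0) := by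
      have h3 := ((continuous_const (y := y 0)).matrix_vecMul continuous_id).tendsto
        (0 : Matrix (Fin m) (Fin m) ℝ)
      simp only [id, Matrix.vecMul_zero] at h3
      exact h3.comp (hElim.comp (tendsto_add_atTop_nat 1))
    have h4 := (hy1.sub h2).sub h1
    simp only [sub_zero] at h4
    exact h4.congr fun k => by simp only [u, Nat.add_sub_cancel]; rfl
  have hpart : ∀ n, u k = ∑ i ∈ Finset.range n, β (k + i) ᵥ* G ^ i + u (k + n) ᵥ* G ^ n := by
    intro n
    induction n with
    | zero => simp
    | succ n ih =>
      rw [ih, hrec (k + n), Finset.sum_range_succ, Matrix.add_vecMul, Matrix.vecMul_vecMul,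
        ← pow_succ', add_assoc, add_assoc]
  refine Pi.hasSum.2 fun c => ?_
  rw [hasSum_iff_tendsto_nat_of_nonneg fun n => Nonneg.vecMul (hβ (k + n)) (hG0.pow n) c]
  have hrem : Tendsto (fun n => (u (k + n) ᵥ* G ^ n) c) atTop (𝓝 0) := by
    have hb : Tendsto (fun n => ∑ a, ‖u (k + n) a‖) atTop (𝓝 0) := by
      have h0 : Tendsto (fun n => ∑ a, ‖u (k + n) a‖) atTop (𝓝 (∑ _a : Fin m, ‖(0 : ℝ)‖)) := by
        refine tendsto_finsetSum _ fun a _ => ?_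
        have := (tendsto_pi_nhds.1 hulim a).comp (tendsto_add_atTop_nat k)
        simp only [Function.comp_def, add_comm _ k] at this
        exact this.norm
      simpa using h0
    refine squeeze_zero_norm (fun n => ?_) hb
    refine (norm_sum_le Finset.univ fun a => u (k + n) a * (G ^ n) a c).trans
      (Finset.sum_le_sum fun a _ => ?_)
    rw [norm_mul, Real.norm_of_nonneg (hG0.pow n a c)]
    exact mul_le_of_le_one_right (norm_nonneg _) (G_pow_le_one h hG n a c)
  have h1 := hrem.const_sub (u k c)
  rw [sub_zero] at h1
  refine h1.congr fun n => ?_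
  have h2 := congrFun (hpart n) c
  rw [Pi.add_apply, Finset.sum_apply] at h2
  rw [h2, add_sub_cancel_right]

end Blocks

/-! ### Row vectors times the inverses of the three factors -/

section StrictUpper

variable {m : ℕ} {T : BlockMatrix m}

theorem sum_vecMul_one (w : ℕ → Fin m → ℝ) {s : Finset ℕ} {i : ℕ} (hi : i ∈ s) :
    ∑ j ∈ s, w j ᵥ* (1 : BlockMatrix m) j i = w i := by
  have h : ∀ j ∈ s, j ≠ i → w j ᵥ* (1 : BlockMatrix m) j i = 0 := fun j _ hj => by
    rw [Matrix.one_apply_ne hj, Matrix.vecMul_zero]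
  rw [Finset.sum_eq_single_of_mem i hi h, Matrix.one_apply_eq, Matrix.vecMul_one]

theorem minInv_eq_zero_of_strictUpper (h : ∀ i j, j ≤ i → T i j = 0) {i k : ℕ} (hk : k < i) :
    minInv T i k = 0 := by
  have h0 : ∀ n, blockPow T n i k = 0 := fun n => blockPow_eq_zero_of_strictUpper h (by omega)
  simp only [minInv, h0, tsum_zero]

/-- If `v = w (I - T)` with `T` strictly upper triangular, then `w = v (I - T)⁻¹`. -/
theorem isVecMul_minInv_of_strictUpper (hu : ∀ i j, j ≤ i → T i j = 0) (hT : HasMinInv T)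
    {v w : ℕ → Fin m → ℝ} (hv : ∀ k, v k = w k - ∑ j ∈ Finset.range k, w j ᵥ* T j k) :
    IsVecMul v (minInv T) w := by
  intro k
  -- Upper triangularity makes column k of the inverse end at row k, so only finite sums have to be
  -- rearranged.
  have h1 : ∀ j, ∑ i ∈ Finset.range (k + 1), (1 - T) j i * minInv T i k =
      (1 : BlockMatrix m) j k := fun j => by
    refine (hasSum_sum_of_ne_finset_zero fun i hi => ?_).unique (hT.2.1 j k)
    rw [minInv_eq_zero_of_strictUpper hu (by rw [Finset.mem_range] at hi; omega), mul_zero]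
  have h2 : ∀ i ∈ Finset.range (k + 1),
      v i = ∑ j ∈ Finset.range (k + 1), w j ᵥ* (1 - T) j i := fun i hi => by
    have h3 : ∑ j ∈ Finset.range (k + 1), w j ᵥ* (1 : BlockMatrix m) j i = w i :=
      sum_vecMul_one w hi
    have h4 : ∑ j ∈ Finset.range (k + 1), w j ᵥ* T j i = ∑ j ∈ Finset.range i, w j ᵥ* T j i := by
      refine (Finset.sum_subset (fun j hj => ?_) fun j _ hj => ?_).symm
      · rw [Finset.mem_range] at hi hj ⊢
        omega
      · rw [hu j i (by simpa using hj), Matrix.vecMul_zero]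
    rw [hv i, ← h4]
    nth_rewrite 1 [← h3]
    rw [← Finset.sum_sub_distrib]
    exact Finset.sum_congr rfl fun j _ => (Matrix.vecMul_sub _ _ _).symm
  have h3 : w k = ∑ i ∈ Finset.range (k + 1), v i ᵥ* minInv T i k := by
    have h4 : ∀ i ∈ Finset.range (k + 1), v i ᵥ* minInv T i k =
        ∑ j ∈ Finset.range (k + 1), w j ᵥ* ((1 - T) j i * minInv T i k) := fun i hi => by
      rw [h2 i hi, Matrix.sum_vecMul]
      simp only [Matrix.vecMul_vecMul]
    rw [Finset.sum_congr rfl h4, Finset.sum_comm]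
    simp only [← Matrix.vecMul_sum, h1]
    exact (sum_vecMul_one w (Finset.self_mem_range_succ k)).symm
  rw [h3]
  refine hasSum_sum_of_ne_finset_zero fun i hi => ?_
  rw [minInv_eq_zero_of_strictUpper hu (by rw [Finset.mem_range] at hi; omega),
    Matrix.vecMul_zero]

theorem isVecMul_minInv_subdiagonal (G : Matrix (Fin m) (Fin m) ℝ) {b u : ℕ → Fin m → ℝ}
    (h : ∀ k, HasSum (fun n => b (k + n) ᵥ* G ^ n) (u k)) :
    IsVecMul b (minInv fun i j => if i = j + 1 then G else 0) u := by
  intro k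
  rw [← (add_right_injective k).hasSum_iff]
  · convert h k using 2 with n
    simp only [Function.comp_apply]
    rw [minInv_subdiagonal, if_pos (Nat.le_add_right k n), Nat.add_sub_cancel_left]
  · intro i hi
    have : ¬ k ≤ i := fun hki => hi ⟨i - k, Nat.add_sub_cancel' hki⟩
    rw [minInv_subdiagonal, if_neg this, Matrix.vecMul_zero]

theorem isVecMul_minInv_diagonal (d : ℕ → Matrix (Fin m) (Fin m) ℝ) (u : ℕ → Fin m → ℝ) :
    IsVecMul u (minInv (Matrix.diagonal d)) fun k => u k ᵥ* ∑' n, d k ^ n := by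
  intro k
  convert hasSum_single (f := fun i => u i ᵥ* minInv (Matrix.diagonal d) i k) k
    (fun j hj => ?_) using 1
  · rw [minInv_diagonal, if_pos rfl]
  · rw [minInv_diagonal, if_neg hj, Matrix.vecMul_zero]

end StrictUpper

/-! ### The R-measure and the two formulas for the tails -/

namespace Blocks

variable {m₀ m : ℕ} {D : Blocks m₀ m} {G : Matrix (Fin m) (Fin m) ℝ}

theorem R_eq (j : ℕ) : D.R G j = powSum (fun k => D.A (k + 1)) G j * (1 - D.Psi G)⁻¹ := by
  simp only [R, powSum, add_right_comm j _ 1]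

theorem RHat0_eq (j : ℕ) :
    D.RHat0 G j = powSum (fun k => D.ATail (k + 1)) G j * (1 - D.Psi G)⁻¹ := by
  simp only [RHat0, powSum, add_right_comm j _ 1]

theorem G1_eq (h : IsStochastic D.transition) (hG : D.IsMinimalSolution G)
    (hΨ : Summable (fun n => D.Psi G ^ n)) : D.G1 G = G := by
  rw [G1, inv_one_sub hΨ, ← one_sub_Psi_mul h hG, ← mul_assoc, hΨ.tsum_pow_mul_one_sub, one_mul]

theorem PsiHat0_eq (h : IsStochastic D.transition) (hG : D.IsMinimalSolution G)
    (hΨ : Summable (fun n => D.Psi G ^ n)) (hs : Summable (fun l => D.ATail (l + 1) * G ^ l)) :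
    Summable (fun k => D.ATail (k + 2) * G ^ k * D.G1 G) ∧
      D.PsiHat0 G = powSum (fun k => D.ATail (k + 1)) G 0 := by
  have hsum : ∀ k, Summable (fun l => D.ATail (k + l + 1) * G ^ l) :=
    summable_ATail_mul_pow h hG.1 hs
  have h1 := HasSum.mulMatrix_const G (hsum 1).hasSum
  have h2 : ∀ l, 1 + l + 1 = l + 2 := fun l => by omega
  simp only [h2] at h1
  rw [PsiHat0, G1_eq h hG hΨ]
  refine ⟨h1.summable, ?_⟩
  rw [powSum_eq_add (C := fun k => D.ATail (k + 1)) hsum 0, h1.tsum_eq, powSum]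
  simp only [zero_add, h2]

theorem lowerG_eq (h : IsStochastic D.transition) (hG : D.IsMinimalSolution G)
    (hΨ : Summable (fun n => D.Psi G ^ n)) :
    D.lowerG G = fun i j => if i = j + 1 then G else 0 := by
  funext i j
  simp only [lowerG, G1_eq h hG hΨ, ite_self]

theorem inv_one_sub_Psi_nonneg (h : IsStochastic D.transition) (hG : D.IsMinimalSolution G)
    (hΨ : Summable (fun n => D.Psi G ^ n)) : Nonneg (1 - D.Psi G)⁻¹ := by
  rw [inv_one_sub hΨ]
  exact Nonneg.tsum fun n => (Psi_nonneg (A_nonneg h) hG.1).pow n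

theorem R_nonneg (h : IsStochastic D.transition) (hG : D.IsMinimalSolution G)
    (hΨ : Summable (fun n => D.Psi G ^ n)) (j : ℕ) : Nonneg (D.R G j) := by
  rw [R_eq]
  exact (powSum_nonneg (fun k => A_nonneg h _) hG.1 j).mul (inv_one_sub_Psi_nonneg h hG hΨ)

theorem RDiff_nonneg (h : IsStochastic D.transition) (hG : D.IsMinimalSolution G)
    (hΨ : Summable (fun n => D.Psi G ^ n)) (i j : ℕ) : Nonneg (D.RDiff G i j) := by
  rw [RDiff]
  split_ifs
  exacts [R_nonneg h hG hΨ _, Nonneg.zero]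

theorem R0_nonneg (h : IsStochastic D.transition) (hG : D.IsMinimalSolution G)
    (hΨ : Summable (fun n => D.Psi G ^ n)) (j : ℕ) : Nonneg (D.R0 G (j + 1)) := by
  have hG0 : Nonneg G := hG.1
  refine (Nonneg.tsum fun k => ?_).mul (inv_one_sub_Psi_nonneg h hG hΨ)
  refine Nonneg.mul ?_ (hG0.pow k)
  rw [show j + 1 + 1 + k = j + k + 2 by omega]
  exact B_nonneg h _

theorem RU_eq_zero (i j : ℕ) (hij : j ≤ i) : D.RU G i j = 0 := if_neg (by omega)

theorem RU_nonneg (h : IsStochastic D.transition) (hG : D.IsMinimalSolution G)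
    (hΨ : Summable (fun n => D.Psi G ^ n)) (i j : ℕ) : Nonneg (D.RU G i j) := by
  rw [RU]
  split_ifs
  · rw [RHat0_eq]
    exact (powSum_nonneg (fun k => ATail_nonneg h _) hG.1 j).mul (inv_one_sub_Psi_nonneg h hG hΨ)
  · exact R_nonneg h hG hΨ _
  · exact Nonneg.zero

/-- Ramaswami's recursion for the stationary vector of a chain of M/G/1 type. -/
theorem levelSucc_recursion (h : IsStochastic D.transition) (hG : D.IsMinimalSolution G)
    (hΨ : Summable (fun n => D.Psi G ^ n)) (hR : Summable (powSum (fun k => D.A (k + 1)) G))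
    {x : State m₀ m → ℝ} (hx : IsStationary D.transition x) (k : ℕ) :
    levelSucc x k = levelZero x ᵥ* D.R0 G (k + 1) +
      ∑ i ∈ Finset.range k, levelSucc x i ᵥ* D.R G (k - i) := by
  set R' := powSum (fun k => D.A (k + 1)) G with hR'
  have hrec : ∀ k, R' k = D.A (k + 1) + R' (k + 1) * G :=
    powSum_eq_add (C := fun k => D.A (k + 1)) (summable_A_succ_mul_pow h hG)
  have hR0 : R' 0 = D.Psi G := Psi_eq.symm
  -- For the killed chain row 0 is A₁, A₂, …, so the boundary sequence E coincides with R'.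
  have h1 := hasSum_mul_pow_of_eq h hG (C := fun k => D.A (k + 1)) hrec hrec hR0
    hR.tendsto_atTop_zero hR (β := fun k => levelZero x ᵥ* D.B (k + 2)) (y := levelSucc x)
    (fun k => Nonneg.vecMul (levelZero_nonneg hx) (B_nonneg h k))
    (summable_levelSucc hx).tendsto_atTop_zero (fun k => by
      have h2 := congrFun (levelSucc_eq hx) k
      rw [Pi.add_apply, vecStep_killed, Finset.sum_range_succ'] at h2
      simpa only [Nat.add_sub_add_right, Nat.sub_zero] using h2) k
  have h2 := HasSum.const_vecMul (levelZero x) (summable_B_mul_pow h hG k).hasSum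
  simp only [← Matrix.vecMul_vecMul, add_right_comm k 2] at h2
  have h3 := h1.unique h2
  have h4 : levelSucc x k ᵥ* (1 - D.Psi G) = levelZero x ᵥ* (∑' l, D.B (k + l + 2) * G ^ l) +
      ∑ i ∈ Finset.range k, levelSucc x i ᵥ* R' (k - i) := by
    have h5 : ∑ i ∈ Finset.range (k + 1), levelSucc x i ᵥ* R' (k - i) =
        ∑ i ∈ Finset.range k, levelSucc x (i + 1) ᵥ* R' (k - 1 - i) + levelSucc x 0 ᵥ* R' k := by
      rw [Finset.sum_range_succ']
      congr 1
      refine Finset.sum_congr rfl fun i _ => ?_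
      rw [show k - (i + 1) = k - 1 - i by omega]
    rw [Finset.sum_range_succ, Nat.sub_self, hR0] at h5
    rw [← h3, Matrix.vecMul_sub, Matrix.vecMul_one, eq_sub_of_add_eq h5]
    abel
  have h5 : levelSucc x k = (levelSucc x k ᵥ* (1 - D.Psi G)) ᵥ* (1 - D.Psi G)⁻¹ := by
    rw [Matrix.vecMul_vecMul, inv_one_sub hΨ, hΨ.one_sub_mul_tsum_pow, Matrix.vecMul_one]
  rw [h5, h4, Matrix.add_vecMul, Matrix.sum_vecMul, Matrix.vecMul_vecMul, R0]
  simp only [Matrix.vecMul_vecMul, R_eq, ← hR', show ∀ l, k + 1 + 1 + l = k + l + 2 from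
    fun l => by omega]

/-- The recursion gives x₀R_{0,j} ≤ x_j, which is summable, and irreducibility makes every entry of
x₀ positive. -/
theorem summable_R0 (h : IsStochastic D.transition) (hirr : D.transition.IsIrreducible)
    (hG : D.IsMinimalSolution G)
    (hΨ : Summable (fun n => D.Psi G ^ n)) (hR : Summable (powSum (fun k => D.A (k + 1)) G))
    {x : State m₀ m → ℝ} (hx : IsStationary D.transition x) :
    Summable (fun j => D.R0 G (j + 1)) := by
  refine summable_matrix_iff.2 fun a b => ?_
  have hpos := stationary_pos h hirr hx (Sum.inl a)
  refine Summable.of_nonneg_of_le (fun j => R0_nonneg h hG hΨ j a b) (fun j => ?_)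
    ((Pi.summable.1 (summable_levelSucc hx) b).mul_left (x (Sum.inl a))⁻¹)
  rw [inv_mul_eq_div, le_div_iff₀ hpos, mul_comm, levelSucc_recursion h hG hΨ hR hx j]
  have h1 : 0 ≤ ∑ i ∈ Finset.range j, levelSucc x i ᵥ* D.R G (j - i) :=
    Finset.sum_nonneg fun i _ => Nonneg.vecMul (levelSucc_nonneg hx i) (R_nonneg h hG hΨ _)
  refine le_add_of_le_of_nonneg ?_ (h1 b)
  exact Finset.single_le_sum (f := fun a => levelZero x a * D.R0 G (j + 1) a b)
    (fun a _ => mul_nonneg (levelZero_nonneg hx a) (R0_nonneg h hG hΨ j a b)) (Finset.mem_univ a)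

theorem summable_RDiff (hR : Summable (powSum (fun k => D.A (k + 1)) G)) (i k : ℕ) :
    Summable (fun j => D.RDiff G i (k + j)) := by
  have h1 : Summable (D.RDiff G i) := by
    rw [← summable_nat_add_iff (i + 1)]
    have h2 := (HasSum.mulMatrix_const (1 - D.Psi G)⁻¹
      ((summable_nat_add_iff 1).2 hR).hasSum).summable
    refine h2.congr fun n => ?_
    rw [RDiff, if_pos (by omega), R_eq, show n + (i + 1) - i = n + 1 by omega]
  exact h1.comp_injective (add_right_injective k)

/-- The tails of the stationary vector through the `R`-measure. -/
theorem tail_eq_R (h : IsStochastic D.transition) (hirr : D.transition.IsIrreducible)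
    (hG : D.IsMinimalSolution G)
    (hΨ : Summable (fun n => D.Psi G ^ n)) (hR : Summable (powSum (fun k => D.A (k + 1)) G))
    {x : State m₀ m → ℝ} (hx : IsStationary D.transition x) (k : ℕ) :
    Summable (fun j => D.R0 G (k + 1 + j)) ∧
      (∀ i : ℕ, Summable (fun j => D.RDiff G (i + 1) (k + 1 + j))) ∧
      Summable (fun i => levelSucc x i ᵥ* ∑' j, D.RDiff G (i + 1) (k + 1 + j)) ∧
      tail x k = levelZero x ᵥ* (∑' j, D.R0 G (k + 1 + j)) +
        ∑' i, levelSucc x i ᵥ* ∑' j, D.RDiff G (i + 1) (k + 1 + j) := by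
  have h0 : Summable (fun j => D.R0 G (k + 1 + j)) := by
    simpa only [Function.comp_def, add_right_comm k 1] using
      (summable_R0 h hirr hG hΨ hR hx).comp_injective (add_right_injective k)
  have hRD := fun i => summable_RDiff hR (i + 1) (k + 1)
  -- Index i stands for level i + 1. The zero convention of `RDiff` turns the finite sum of the
  -- recursion into a series in i, ready for Tonelli against j.
  have h1 : ∀ j, HasSum (fun i => levelSucc x i ᵥ* D.RDiff G (i + 1) (k + 1 + j))
      (levelSucc x (k + j) - levelZero x ᵥ* D.R0 G (k + 1 + j)) := fun j => by
    rw [levelSucc_recursion h hG hΨ hR hx (k + j), add_right_comm k 1, add_sub_cancel_left]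
    have h2 : ∀ i ∈ Finset.range (k + j), levelSucc x i ᵥ* D.R G (k + j - i) =
        levelSucc x i ᵥ* D.RDiff G (i + 1) (k + j + 1) := fun i hi => by
      rw [Finset.mem_range] at hi
      rw [RDiff, if_pos (by omega), Nat.add_sub_add_right]
    rw [Finset.sum_congr rfl h2]
    refine hasSum_sum_of_ne_finset_zero fun i hi => ?_
    rw [Finset.mem_range] at hi
    rw [RDiff, if_neg (by omega), Matrix.vecMul_zero]
  have h2 := (hasSum_tails (summable_levelSucc hx) k).sub
    (HasSum.const_vecMul (levelZero x) h0.hasSum)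
  have h3 := (tonelli_vec (fun j i => Nonneg.vecMul (levelSucc_nonneg hx i)
    (RDiff_nonneg h hG hΨ (i + 1) (k + 1 + j))) h1 h2).2
  simp only [(HasSum.const_vecMul _ (hRD _).hasSum).tsum_eq] at h3
  refine ⟨h0, hRD, h3.summable, ?_⟩
  rw [h3.tsum_eq, add_sub_cancel]
  rfl

theorem hasMinInv_PsiD (h : IsStochastic D.transition) (hG : D.IsMinimalSolution G)
    (hs : ∀ i k, Summable (fun n => blockPow D.tailMatrix n i k)) :
    (∀ i, Summable fun n => (if i = 0 then D.PsiHat0 G else D.Psi G) ^ n) ∧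
      HasMinInv (D.PsiD G) := by
  have hΨ := summable_Psi_pow h hG hs
  obtain ⟨hsum, hsup⟩ := ATail_summable_and_super h hG hs
  have hhat := (PsiHat0_eq h hG hΨ hsum).2
  have hhat0 : Nonneg (D.PsiHat0 G) := by
    rw [hhat]; exact powSum_nonneg (fun k => ATail_nonneg h _) hG.1 0
  have hd : ∀ i, Summable fun n => (if i = 0 then D.PsiHat0 G else D.Psi G) ^ n := fun i => by
    split_ifs
    · refine summable_pow_of_super hhat0 (minInv_nonneg (tailMatrix_nonneg h) 0 0) ?_
      rw [hhat]
      simpa only [powSum, zero_add] using hsup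
    · exact hΨ
  refine ⟨hd, hasMinInv_of_summable (fun i j => ?_) (fun i j hij => ?_)
    (summable_blockPow_diagonal hd)⟩
  · rw [PsiD, Matrix.diagonal_apply]
    split_ifs
    exacts [hhat0, Psi_nonneg (A_nonneg h) hG.1, Nonneg.zero]
  · rw [PsiD, Matrix.diagonal_apply_ne _ (by omega)]

theorem hasMinInv_lowerG (h : IsStochastic D.transition) (hG : D.IsMinimalSolution G)
    (hΨ : Summable (fun n => D.Psi G ^ n)) : HasMinInv (D.lowerG G) := by
  have hG0 : Nonneg G := hG.1
  rw [lowerG_eq h hG hΨ]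
  refine hasMinInv_of_summable (fun i j => ?_) (fun i j hij => if_neg (by omega))
    (summable_blockPow_subdiagonal G)
  split_ifs
  exacts [hG0, Nonneg.zero]

theorem hasMinInv_RU (h : IsStochastic D.transition) (hG : D.IsMinimalSolution G)
    (hΨ : Summable (fun n => D.Psi G ^ n)) : HasMinInv (D.RU G) :=
  hasMinInv_of_summable (RU_nonneg h hG hΨ) (fun i j hij => RU_eq_zero i j (by omega))
    (summable_blockPow_of_strictUpper RU_eq_zero)

/-- The factorization of the tails through the `RG`-factorization of the tail matrix. -/
theorem exists_isVecMul_tail (h : IsStochastic D.transition) (hG : D.IsMinimalSolution G)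
    (hs : ∀ i k, Summable (fun n => blockPow D.tailMatrix n i k))
    {x : State m₀ m → ℝ} (hx : IsStationary D.transition x) :
    ∃ u v : ℕ → Fin m → ℝ,
      IsVecMul (D.boundary x) (minInv (D.lowerG G)) u ∧
      IsVecMul u (minInv (D.PsiD G)) v ∧
      IsVecMul v (minInv (D.RU G)) (tail x) := by
  have hΨ := summable_Psi_pow h hG hs
  obtain ⟨hsum, -⟩ := ATail_summable_and_super h hG hs
  have hd := (hasMinInv_PsiD h hG hs).1
  have hhat := (PsiHat0_eq h hG hΨ hsum).2
  set R' := powSum (fun k => D.A (k + 1)) G with hR'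
  set E := powSum (fun k => D.ATail (k + 1)) G with hE
  have hRrec : ∀ k, R' k = D.A (k + 1) + R' (k + 1) * G :=
    powSum_eq_add (C := fun k => D.A (k + 1)) (summable_A_succ_mul_pow h hG)
  have hErec : ∀ k, E k = D.ATail (k + 1) + E (k + 1) * G :=
    powSum_eq_add (C := fun k => D.ATail (k + 1)) (summable_ATail_mul_pow h hG.1 hsum)
  have hR0 : R' 0 = D.Psi G := Psi_eq.symm
  have hRsum : ∀ k, HasSum (fun j => R' (k + j)) (E k) := hasSum_powSum_A h hG.1 hsum
  have hR : Summable R' := by simpa only [zero_add] using (hRsum 0).summable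
  have hElim : Tendsto E atTop (𝓝 0) := by
    refine (_root_.tendsto_sum_nat_add R').congr fun k => ?_
    simp only [add_comm _ k, (hRsum k).tsum_eq]
  have hu := hasSum_mul_pow_of_eq h hG (C := fun k => D.ATail (k + 1)) hErec hRrec hR0 hElim hR
    (boundary_nonneg h hx) (tendsto_tails (levelSucc x)) fun k => by
      rw [← vecStep_tailMatrix]
      exact congrFun (tail_eq h hx) k
  refine ⟨_, _, by rw [lowerG_eq h hG hΨ]; exact isVecMul_minInv_subdiagonal G hu,
    isVecMul_minInv_diagonal _ _, isVecMul_minInv_of_strictUpper RU_eq_zero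
      (hasMinInv_RU h hG hΨ) fun k => ?_⟩
  change (tail x k - tail x 0 ᵥ* E k -
    ∑ i ∈ Finset.range k, tail x (i + 1) ᵥ* R' (k - 1 - i)) ᵥ* _ = _
  -- This recognises u as π(I - R_U)(I - Ψ_D), after which the two factors are inverted in turn.
  have hcancel : tail x k - tail x 0 ᵥ* E k -
      ∑ i ∈ Finset.range k, tail x (i + 1) ᵥ* R' (k - 1 - i) =
      (tail x k - ∑ j ∈ Finset.range k, tail x j ᵥ* D.RU G j k) ᵥ*
        (1 - if k = 0 then D.PsiHat0 G else D.Psi G) := by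
    cases k with
    | zero => simp [hhat, Matrix.vecMul_sub]
    | succ k =>
      have hinv : (1 - D.Psi G)⁻¹ * (1 - D.Psi G) = 1 := by
        rw [inv_one_sub hΨ, hΨ.tsum_pow_mul_one_sub]
      have h1 : ∑ j ∈ Finset.range (k + 1), (tail x j ᵥ* D.RU G j (k + 1)) ᵥ* (1 - D.Psi G) =
          ∑ i ∈ Finset.range k, tail x (i + 1) ᵥ* R' (k - i) + tail x 0 ᵥ* E (k + 1) := by
        rw [Finset.sum_range_succ']
        congr 1
        · refine Finset.sum_congr rfl fun i hi => ?_
          rw [Finset.mem_range] at hi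
          rw [RU, if_pos (by omega), if_neg (by omega), R_eq, Matrix.vecMul_vecMul, mul_assoc, hinv,
            mul_one, Nat.add_sub_add_right]
        · rw [RU, if_pos (by omega), if_pos rfl, RHat0_eq, Matrix.vecMul_vecMul, mul_assoc, hinv,
            mul_one]
      rw [if_neg (by omega), Matrix.sub_vecMul, Matrix.sum_vecMul, h1, Finset.sum_range_succ,
        Matrix.vecMul_sub, Matrix.vecMul_one, Nat.add_sub_cancel, Nat.sub_self, hR0]
      abel
  rw [hcancel, Matrix.vecMul_vecMul, (hd k).one_sub_mul_tsum_pow, Matrix.vecMul_one]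

end Blocks

end MG1

end

theorem mainTheorem6 {m₀ m : ℕ} (D : MG1.Blocks m₀ m)
    (hstoch : MG1.IsStochastic D.transition)
    (hirr : D.transition.IsIrreducible)
    (hrec : MG1.IsPositiveRecurrent D.transition)
    (x : MG1.State m₀ m → ℝ) (hx : MG1.IsStationary D.transition x)
    (G : Matrix (Fin m) (Fin m) ℝ) (hG : D.IsMinimalSolution G) :
    -- the series that define the tails, `Ψ` and the `R`-measure converge; `I - Ψ` is invertible
    (Summable (MG1.levelSucc x) ∧
      Summable (fun k => D.A (k + 1) * G ^ k) ∧
      IsUnit (1 - D.Psi G) ∧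
      (∀ j, Summable (fun k => D.B (j + 2 + k) * G ^ k)) ∧
      (∀ j, Summable (fun k => D.A (j + 2 + k) * G ^ k))) ∧
    -- the tails through the `R`-measure (the level index `k` of the formula is `k + 1` here)
    (∀ k : ℕ,
      Summable (fun j => D.R0 G (k + 1 + j)) ∧
      (∀ i : ℕ, Summable (fun j => D.RDiff G (i + 1) (k + 1 + j))) ∧
      Summable (fun i => MG1.levelSucc x i ᵥ* ∑' j, D.RDiff G (i + 1) (k + 1 + j)) ∧
      MG1.tail x k = MG1.levelZero x ᵥ* (∑' j, D.R0 G (k + 1 + j)) +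
        ∑' i, MG1.levelSucc x i ᵥ* ∑' j, D.RDiff G (i + 1) (k + 1 + j)) ∧
    -- the series that define the factors of the `RG`-factorization and the boundary vector
    -- converge
    (Summable D.A ∧
      Summable (fun k => D.B (k + 2)) ∧
      Summable (fun k => D.ATail (k + 2) * G ^ k * D.G1 G) ∧
      (∀ j, Summable (fun k => D.ATail (j + 2 + k) * G ^ k))) ∧
    -- the infinite matrices below have minimal inverses
    (MG1.HasMinInv D.tailMatrix ∧ MG1.HasMinInv (D.lowerG G) ∧ MG1.HasMinInv (D.PsiD G) ∧
      MG1.HasMinInv (D.RU G)) ∧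
    -- `π = b (I - P)⁻¹ = b (I - G_L)⁻¹ (I - Ψ_D)⁻¹ (I - R_U)⁻¹`, with `P` the matrix `tailMatrix`
    MG1.IsVecMul (D.boundary x) (MG1.minInv D.tailMatrix) (MG1.tail x) ∧
    ∃ u v : ℕ → Fin m → ℝ,
      MG1.IsVecMul (D.boundary x) (MG1.minInv (D.lowerG G)) u ∧
      MG1.IsVecMul u (MG1.minInv (D.PsiD G)) v ∧
      MG1.IsVecMul v (MG1.minInv (D.RU G)) (MG1.tail x) := by
  have hs := MG1.Blocks.summable_blockPow_tailMatrix hstoch hirr hx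
  have hΨ := MG1.Blocks.summable_Psi_pow hstoch hG hs
  have hAT := (MG1.Blocks.ATail_summable_and_super hstoch hG hs).1
  have hR : Summable (MG1.Blocks.powSum (fun k => D.A (k + 1)) G) := by
    simpa only [zero_add] using (MG1.Blocks.hasSum_powSum_A hstoch hG.1 hAT 0).summable
  refine ⟨⟨MG1.Blocks.summable_levelSucc hx, ?_, MG1.isUnit_one_sub hΨ,
      MG1.Blocks.summable_B_mul_pow hstoch hG,
      fun j => MG1.Blocks.summable_A_mul_pow hstoch hG (j + 2)⟩,
    MG1.Blocks.tail_eq_R hstoch hirr hG hΨ hR hx,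
    ⟨MG1.Blocks.summable_A hstoch, MG1.Blocks.summable_B hstoch,
      (MG1.Blocks.PsiHat0_eq hstoch hG hΨ hAT).1, fun j => ?_⟩,
    ⟨MG1.hasMinInv_of_summable (MG1.Blocks.tailMatrix_nonneg hstoch)
        MG1.Blocks.tailMatrix_eq_zero hs,
      MG1.Blocks.hasMinInv_lowerG hstoch hG hΨ, (MG1.Blocks.hasMinInv_PsiD hstoch hG hs).2,
      MG1.Blocks.hasMinInv_RU hstoch hG hΨ⟩,
    MG1.isVecMul_minInv (MG1.Blocks.tailMatrix_nonneg hstoch) MG1.Blocks.tailMatrix_eq_zero hs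
      (MG1.Blocks.boundary_nonneg hstoch hx) (MG1.Blocks.tail_eq hstoch hx)
      (MG1.Blocks.tendsto_iterate_tailMatrix hstoch hirr hx),
    MG1.Blocks.exists_isVecMul_tail hstoch hG hs hx⟩
  · simpa only [zero_add] using MG1.Blocks.summable_A_succ_mul_pow hstoch hG 0
  · simpa only [show ∀ k, j + 1 + k + 1 = j + 2 + k from fun k => by omega] using
      MG1.Blocks.summable_ATail_mul_pow hstoch hG.1 hAT (j + 1)
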